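/- Let $\mathbb S^1=\mathbb R/\mathbb Z$, let $k\ge 1$ be an integer, let $C^k(\mathbb S^1,\mathbb R^2)$ be the Banach space of $C^k$ maps with the usual $C^k$ norm, and let $\mathrm{Imm}^k=\{\gamma\in C^k(\mathbb S^1,\mathbb R^2): \gamma'(u)\ne 0 \text{ for all } u\}$, an open subset of it. For $x\in\mathrm{Imm}^k$ put $s_x(u)=\int_0^u|x'(v)|\,dv$ and $\mathcal L(x)=s_x(1)$, and for $u,\tilde u\in[0,1]$ $$G(x;u,\tilde u)=\frac{\cosh\!\big(|s_x(u)-s_x(\tilde u)|-\tfrac{\mathcal L(x)}2\big)}{2\sinh\!\big(-\tfrac{\mathcal L(x)}2\big)},\qquad F(x;u)=-x(u)-\int_0^1 x(\tilde u)\,G(x;u,\tilde u)\,|x'(\tilde u)|\,d\tilde u .$$ ($F(x)$ is minus the gradient of length at $x$ for the Riemannian metric $\langle v,w\rangle_{H^1(ds)}=\int\langle v,w\rangle\,ds+\int\langle v_s,w_s\rangle\,ds$.) An eternal $H^1(ds)$ curve shortening flow in $C^1(\mathbb R;\mathrm{Imm}^k)$ is a map $X\in C^1(\mathbb R;C^k(\mathbb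 S^1,\mathbb R^2))$ with $X(\cdot,t)\in\mathrm{Imm}^k$ for all $t$ and $\partial_tX(u,t)=F(X(\cdot,t);u)$ for all $t\in\mathbb R$ and $u\in[0,1]$. Theorem. For each $k\ge1$ and each $X_0\in\mathrm{Imm}^k$ there exists a unique eternal $H^1(ds)$ curve shortening flow $X$ in $C^1(\mathbb R;\mathrm{Imm}^k)$ with $X(\cdot,0)=X_0$. Furthermore, let $L_0=\mathcal L(X_0)$ and $\|X_0\|_\infty=\sup_u|X_0(u)|$, and for distinct $u_1,u_2\in\mathbb S^1$ let $\mathcal Ch=|X_0(u_1)-X_0(u_2)|$ be the chord length and $\mathcal S$ the length of the shorter of the two arcs of $X_0$ joining $u_1$ and $u_2$. If $$\inf_{u_1\neq u_2}\frac{\mathcal Ch}{\mathcal S}>\frac{L_0^2\sqrt{2+\|X_0\|_\infty^2}}{4}\,e^{\frac{L_0^2\sqrt{2+\|X_0\|_\infty^2}}{4}},$$ then $X(\cdot,t):\mathbb S^1\to\mathbb R^2$ is an embedding for every $t\ge 0$. -/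

import Mathlib

noncomputable section

namespace H1Flow

/-- The Euclidean plane. -/
abbrev Plane : Type := EuclideanSpace ℝ (Fin 2)

/-- The circle is `ℝ / ℤ` (total measure one), so maps `S¹ → ℝ²` of class `C^k` are the 1-periodic
`C^k` maps `ℝ → ℝ²`; this is the real vector space of all of them. -/
def loopSubmodule (k : ℕ) : Submodule ℝ (ℝ → Plane) where
  carrier := {f | ContDiff ℝ k f ∧ Function.Periodic f 1}
  add_mem' := fun {_ _} hf hg => ⟨hf.1.add hg.1, hf.2.add hg.2⟩
  zero_mem' := ⟨contDiff_const, fun _ => rfl⟩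
  smul_mem' := fun c _ hf => ⟨contDiff_const.smul hf.1, fun u => congrArg (fun p => c • p) (hf.2 u)⟩

/-- The space `C^k(S¹, ℝ²)`. It is a type of its own, so that it carries the `C^k` norm below and
not the topology of pointwise convergence of the space of all functions. -/
def CkLoop (k : ℕ) : Type := ↥(loopSubmodule k)

namespace CkLoop

variable {k : ℕ}

instance : AddCommGroup (CkLoop k) := inferInstanceAs (AddCommGroup ↥(loopSubmodule k))

instance : Module ℝ (CkLoop k) := inferInstanceAs (Module ℝ ↥(loopSubmodule k))

instance : CoeFun (CkLoop k) (fun _ => ℝ → Plane) := ⟨fun x => x.1⟩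

theorem contDiff (x : CkLoop k) : ContDiff ℝ k x := x.2.1

theorem periodic (x : CkLoop k) : Function.Periodic x 1 := x.2.2

theorem add_apply (x y : CkLoop k) (u : ℝ) : (x + y) u = x u + y u := rfl

theorem smul_apply (c : ℝ) (x : CkLoop k) (u : ℝ) : (c • x) u = c • x u := rfl

@[ext]
theorem ext {x y : CkLoop k} (h : ∀ u, x u = y u) : x = y := Subtype.ext (funext h)

theorem iteratedDeriv_periodic (x : CkLoop k) (j : ℕ) :
    Function.Periodic (iteratedDeriv j x) 1 := by
  intro u
  have h : (fun v : ℝ => x (v + 1)) = x := funext x.periodic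
  have h2 := congrFun (iteratedDeriv_comp_add_const j (x : ℝ → Plane) 1) u
  rw [h] at h2
  exact h2.symm

theorem iteratedDeriv_continuous (x : CkLoop k) (j : Fin (k + 1)) :
    Continuous (iteratedDeriv j x) :=
  x.contDiff.continuous_iteratedDeriv j (by exact_mod_cast Nat.lt_succ_iff.mp j.2)

theorem exists_iteratedDeriv_bound (x : CkLoop k) (j : Fin (k + 1)) :
    ∃ C, ∀ u, ‖iteratedDeriv j x u‖ ≤ C := by
  obtain ⟨C, hC⟩ := ((isCompact_Icc (a := (0 : ℝ)) (b := 1)).bddAbove_image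
    (x.iteratedDeriv_continuous j).norm.continuousOn)
  refine ⟨C, fun u => ?_⟩
  obtain ⟨v, hv, hvu⟩ := (x.iteratedDeriv_periodic j).exists_mem_Ico₀ one_pos u
  rw [hvu]
  exact hC ⟨v, ⟨hv.1, hv.2.le⟩, rfl⟩

/-- The derivatives of order at most `k`, as bounded continuous functions. -/
def jet (k : ℕ) : CkLoop k →ₗ[ℝ] (Fin (k + 1) → BoundedContinuousFunction ℝ Plane) where
  toFun x j := BoundedContinuousFunction.ofNormedAddCommGroup (iteratedDeriv j x)
    (x.iteratedDeriv_continuous j) (x.exists_iteratedDeriv_bound j).choose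
    (x.exists_iteratedDeriv_bound j).choose_spec
  map_add' x y := by
    funext j
    ext1 u
    have hj : ((j : ℕ) : WithTop ℕ∞) ≤ k := by exact_mod_cast Nat.lt_succ_iff.mp j.2
    exact iteratedDeriv_add ((x.contDiff.of_le hj).contDiffAt) ((y.contDiff.of_le hj).contDiffAt)
  map_smul' c x := by
    funext j
    ext1 u
    have hj : ((j : ℕ) : WithTop ℕ∞) ≤ k := by exact_mod_cast Nat.lt_succ_iff.mp j.2
    exact iteratedDeriv_const_smul ((x.contDiff.of_le hj).contDiffAt) c

theorem jet_apply (x : CkLoop k) (j : Fin (k + 1)) (u : ℝ) :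
    jet k x j u = iteratedDeriv j x u := rfl

theorem jet_injective (k : ℕ) : Function.Injective (jet k) := by
  intro x y h
  ext1 u
  have h0 := DFunLike.congr_fun (congrFun h 0) u
  simpa [jet_apply] using h0

/-- The `C^k` norm: the maximum over `j ≤ k` of the supremum norm of the `j`-th derivative. -/
instance : NormedAddCommGroup (CkLoop k) :=
  NormedAddCommGroup.induced _ _ (jet k) (jet_injective k)

instance : NormedSpace ℝ (CkLoop k) := NormedSpace.induced ℝ _ _ (jet k)

end CkLoop

/-- The immersions of class `C^k` (used for `1 ≤ k`). -/
def Imm (k : ℕ) : Set (CkLoop k) := {x | ∀ u : ℝ, deriv x u ≠ 0}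

/-- Arc length of `x` from parameter `0` to parameter `u`. -/
def arcLength (x : ℝ → Plane) (u : ℝ) : ℝ := ∫ v in (0 : ℝ)..u, ‖deriv x v‖

/-- The length of the closed curve `x`. -/
def length (x : ℝ → Plane) : ℝ := arcLength x 1

/-- The Green's function, for parameters `u`, `v` in `[0, 1]`. -/
def green (x : ℝ → Plane) (u v : ℝ) : ℝ :=
  Real.cosh (|arcLength x u - arcLength x v| - length x / 2) / (2 * Real.sinh (-(length x / 2)))

/-- The negative of the `H¹(ds)`-gradient of length at `x`, at a parameter `u` in `[0, 1]`. -/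
def velocity (x : ℝ → Plane) (u : ℝ) : Plane :=
  -x u - ∫ v in (0 : ℝ)..1, (green x u v * ‖deriv x v‖) • x v

/-- `X` is an eternal `H¹(ds)` curve shortening flow in `C¹(ℝ; Imm^k)`. The evolution equation is
imposed on the fundamental domain `[0, 1]` of the circle. -/
structure IsEternalFlow (k : ℕ) (X : ℝ → CkLoop k) : Prop where
  contDiff : ContDiff ℝ 1 X
  mem_imm : ∀ t, X t ∈ Imm k
  evolution : ∀ t, ∀ u ∈ Set.Icc (0 : ℝ) 1, HasDerivAt (fun τ => X τ u) (velocity (X t) u) t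

/-- Distance along the closed curve between two of its points, with parameters in `[0, 1]`: the
length of the shorter of the two arcs joining them. -/
def arcDist (x : ℝ → Plane) (u v : ℝ) : ℝ :=
  min |arcLength x u - arcLength x v| (length x - |arcLength x u - arcLength x v|)

/-- Infimum of the chord-arc ratio over all pairs of distinct points of the circle. -/
def chordArcInf (x : ℝ → Plane) : ℝ :=
  sInf {r : ℝ | ∃ u v : ℝ, 0 ≤ u ∧ u < v ∧ v < 1 ∧ r = ‖x u - x v‖ / arcDist x u v}

/-- The supremum norm of a (bounded) curve. -/
def supNorm (x : ℝ → Plane) : ℝ := ⨆ u : ℝ, ‖x u‖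

/-- `x` is an embedding of the circle: an immersion which, as a map on `ℝ / ℤ`, is a homeomorphism
onto its image. -/
def IsEmbeddedLoop {k : ℕ} (x : CkLoop k) : Prop :=
  x ∈ Imm k ∧ Topology.IsEmbedding (x.periodic.lift : AddCircle (1 : ℝ) → Plane)

end H1Flow

end

/-! The field is `F(x) = y - x`, where `y` is the `resolvent` of `x`: the periodic solution of `y -
y_ss = x` in the arc length `s` of `x`. Since `1 - ∂ₛ² = (1 - ∂ₛ)(1 + ∂ₛ)`, `y` is the sum, and `w =
y_s` the difference, of the periodic solutions of `g_s = ε (g - x/2)` for `ε = ±1`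
(`halfResolvent`). Such first-order equations obey a maximum principle (`norm_le_of_periodic_ode`)
and gain one derivative (`UnifBound.of_periodic_ode`). Hence `F` maps `Imm^k` to `C^k` and is
locally Lipschitz, `|y| ≤ sup |x|`, and `|w| ≤ 1`.

Global existence: `X'` evolves by `|X'| w - X'`. As `|w| ≤ 1`, the speed shrinks at most by
`e^{-2|t|}` and the `C¹` norm grows at most exponentially. Higher norms follow by induction on the
order: once the norm one order below is bounded, `y' = |x'| w` shows that `F` grows at most
affinely, and Gronwall applies (`exists_region_of_isSolution`). These a priori bounds give a uniform
local existence time on each bounded time interval, so solutions never stop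
(`exists_isSolution_of_apriori`).

Embeddedness: `w_s = y - x` and `w` has mean zero in `ds`, so `|w| ≤ L²/4`
(`norm_resolventDeriv_le`). The chord-arc infimum is at most `1`, so the hypothesis forces `L₀² ≤
2`. With `B = L₀²/4` it follows that `L ≤ L₀ e^{-t/2}`, `|w| ≤ B e^{-t}` and `|X'| ≤ e^{B-t} |X₀'|`.
Then `e^t (X(b) - X(a))` has time derivative `e^t (y(b) - y(a))`, of norm at most `S B e^B e^{-t}`
with `S` the initial arc length. Its total change is at most `S B e^B`, less than the initial chord,
so the two points never meet (`apply_ne_apply_of_chord_gt`). -/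

noncomputable section

open Set Filter Topology

namespace H1Flow

/-! ### Calculus of uniform `C^j` bounds for families of functions. -/

section UnifBound

variable {ι κ E F G : Type*} [NormedAddCommGroup E] [NormedSpace ℝ E]
  [NormedAddCommGroup F] [NormedSpace ℝ F] [NormedAddCommGroup G] [NormedSpace ℝ G]

/-- A family of functions of class `C^j` whose derivatives of order at most `j` are bounded by a
constant multiple of the weight `d`. -/
def UnifBound (d : ι → ℝ) : ℕ → (ι → ℝ → E) → Prop
  | 0, f => (∀ i, Continuous (f i)) ∧ ∃ C, ∀ i u, ‖f i u‖ ≤ C * d i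
  | j + 1, f => (∀ i, Differentiable ℝ (f i)) ∧ (∃ C, ∀ i u, ‖f i u‖ ≤ C * d i) ∧
      UnifBound d j (fun i => deriv (f i))

namespace UnifBound

variable {d : ι → ℝ} {j : ℕ} {f g : ι → ℝ → E}

theorem bound (h : UnifBound d j f) : ∃ C, ∀ i u, ‖f i u‖ ≤ C * d i := by
  cases j with
  | zero => exact h.2
  | succ j => exact h.2.1

theorem continuous (h : UnifBound d j f) (i : ι) : Continuous (f i) := by
  cases j with
  | zero => exact h.1 i
  | succ j => exact (h.1 i).continuous

theorem pred (h : UnifBound d (j + 1) f) : UnifBound d j f := by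
  induction j generalizing f with
  | zero => exact ⟨h.continuous, h.bound⟩
  | succ j ih => exact ⟨h.1, h.2.1, ih h.2.2⟩

theorem mono {m : ℕ} (h : UnifBound d j f) (hm : m ≤ j) : UnifBound d m f := by
  induction hm with
  | refl => exact h
  | step _ ih => exact ih h.pred

theorem of_hasDerivAt {f' : ι → ℝ → E} (hf : ∀ i u, HasDerivAt (f i) (f' i u) u)
    (hb : ∃ C, ∀ i u, ‖f i u‖ ≤ C * d i) (hf' : UnifBound d j f') : UnifBound d (j + 1) f := by
  refine ⟨fun i u => (hf i u).differentiableAt, hb, ?_⟩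
  have : (fun i => deriv (f i)) = f' := funext fun i => funext fun u => (hf i u).deriv
  rwa [this]

theorem hasDerivAt (h : UnifBound d (j + 1) f) (i : ι) (u : ℝ) :
    HasDerivAt (f i) (deriv (f i) u) u := (h.1 i u).hasDerivAt

theorem comp (h : UnifBound d j f) (φ : κ → ι) :
    UnifBound (fun k => d (φ k)) j (fun k => f (φ k)) := by
  induction j generalizing f with
  | zero => exact ⟨fun i => h.1 _, h.2.imp fun C hC i => hC _⟩
  | succ j ih => exact ⟨fun i => h.1 _, h.2.1.imp fun C hC i => hC _, ih h.2.2⟩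

theorem add (hf : UnifBound d j f) (hg : UnifBound d j g) :
    UnifBound d j (fun i u => f i u + g i u) := by
  have key : ∀ f g : ι → ℝ → E, (∃ C, ∀ i u, ‖f i u‖ ≤ C * d i) →
      (∃ C, ∀ i u, ‖g i u‖ ≤ C * d i) → ∃ C, ∀ i u, ‖f i u + g i u‖ ≤ C * d i := by
    rintro f g ⟨C, hC⟩ ⟨D, hD⟩
    refine ⟨C + D, fun i u => (norm_add_le _ _).trans ?_⟩
    linarith [hC i u, hD i u]
  induction j generalizing f g with
  | zero => exact ⟨fun i => (hf.1 i).add (hg.1 i), key f g hf.2 hg.2⟩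
  | succ j ih =>
    exact of_hasDerivAt (fun i u => (hf.hasDerivAt i u).add (hg.hasDerivAt i u))
      (key f g hf.2.1 hg.2.1) (ih hf.2.2 hg.2.2)

theorem clm (L : E →L[ℝ] F) (hf : UnifBound d j f) : UnifBound d j (fun i u => L (f i u)) := by
  have key : ∀ f : ι → ℝ → E, (∃ C, ∀ i u, ‖f i u‖ ≤ C * d i) →
      ∃ C, ∀ i u, ‖L (f i u)‖ ≤ C * d i := by
    rintro f ⟨C, hC⟩
    refine ⟨‖L‖ * C, fun i u => (L.le_opNorm _).trans ?_⟩
    rw [mul_assoc]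
    exact mul_le_mul_of_nonneg_left (hC i u) (norm_nonneg _)
  induction j generalizing f with
  | zero => exact ⟨fun i => L.continuous.comp (hf.1 i), key f hf.2⟩
  | succ j ih =>
    exact of_hasDerivAt (fun i u => L.hasFDerivAt.comp_hasDerivAt u (hf.hasDerivAt i u))
      (key f hf.2.1) (ih hf.2.2)

theorem const_smul (c : ℝ) (hf : UnifBound d j f) : UnifBound d j (fun i u => c • f i u) :=
  hf.clm (c • ContinuousLinearMap.id ℝ E)

theorem neg (hf : UnifBound d j f) : UnifBound d j (fun i u => -f i u) :=
  hf.clm (-ContinuousLinearMap.id ℝ E)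

theorem sub (hf : UnifBound d j f) (hg : UnifBound d j g) :
    UnifBound d j (fun i u => f i u - g i u) := by
  simpa only [sub_eq_add_neg] using hf.add hg.neg

/-- Every term of the Leibniz rule has one factor of weight `d` and one of weight `1`, so bounds
stay linear in `d`. The weights in use are `1` (boundedness), `‖x - y‖` (Lipschitz bounds) and `1 +
‖x‖` (affine growth). -/
theorem bilin (B : E →L[ℝ] F →L[ℝ] G) {g : ι → ℝ → F} (hf : UnifBound (fun _ => 1) j f)
    (hg : UnifBound d j g) : UnifBound d j (fun i u => B (f i u) (g i u)) := by
  have key : ∀ (f : ι → ℝ → E) (g : ι → ℝ → F), (∃ C, ∀ i u, ‖f i u‖ ≤ C * (1 : ℝ)) →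
      (∃ C, ∀ i u, ‖g i u‖ ≤ C * d i) → ∃ C, ∀ i u, ‖B (f i u) (g i u)‖ ≤ C * d i := by
    rintro f g ⟨C, hC⟩ ⟨D, hD⟩
    refine ⟨‖B‖ * C * D, fun i u => (B.le_opNorm₂ _ _).trans ?_⟩
    have h1 := hC i u
    rw [mul_one] at h1
    have h0 : 0 ≤ C := (norm_nonneg _).trans h1
    rw [mul_assoc (‖B‖ * C)]
    exact mul_le_mul (mul_le_mul_of_nonneg_left h1 (by positivity)) (hD i u) (norm_nonneg _)
      (by positivity)
  induction j generalizing f g with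
  | zero =>
    exact ⟨fun i => (B.continuous.comp (hf.1 i)).clm_apply (hg.1 i), key f g hf.2 hg.2⟩
  | succ j ih =>
    exact of_hasDerivAt (fun i u => B.hasDerivAt_of_bilinear (fun _ => hf.hasDerivAt i u)
      fun _ => hg.hasDerivAt i u) (key f g hf.2.1 hg.2.1) ((ih hf.pred hg.2.2).add (ih hf.2.2 hg.pred))

theorem bilin' (B : E →L[ℝ] F →L[ℝ] G) {g : ι → ℝ → F} (hf : UnifBound d j f)
    (hg : UnifBound (fun _ => 1) j g) : UnifBound d j (fun i u => B (f i u) (g i u)) :=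
  hg.bilin B.flip hf

theorem smul {σ : ι → ℝ → ℝ} (hσ : UnifBound (fun _ => 1) j σ) (hf : UnifBound d j f) :
    UnifBound d j (fun i u => σ i u • f i u) :=
  hσ.bilin (ContinuousLinearMap.lsmul ℝ ℝ) hf

theorem smul' {σ : ι → ℝ → ℝ} (hσ : UnifBound d j σ) (hf : UnifBound (fun _ => 1) j f) :
    UnifBound d j (fun i u => σ i u • f i u) :=
  hσ.bilin' (ContinuousLinearMap.lsmul ℝ ℝ) hf

theorem inv {σ : ι → ℝ → ℝ} {c : ℝ} (hc : 0 < c) (hσ : UnifBound (fun _ => 1) j σ)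
    (hσc : ∀ i u, c ≤ |σ i u|) : UnifBound (fun _ => 1) j (fun i u => (σ i u)⁻¹) := by
  have hb : ∃ C, ∀ i u, ‖(σ i u)⁻¹‖ ≤ C * (1 : ℝ) := by
    refine ⟨c⁻¹, fun i u => ?_⟩
    rw [norm_inv, mul_one]
    exact inv_anti₀ hc (hσc i u)
  have h0 : ∀ i u, σ i u ≠ 0 := fun i u => abs_pos.mp (hc.trans_le (hσc i u))
  induction j with
  | zero => exact ⟨fun i => (hσ.1 i).inv₀ (h0 i), hb⟩
  | succ j ih =>
    refine of_hasDerivAt (fun i u => (hσ.hasDerivAt i u).inv (h0 i u)) hb ?_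
    have h := ((ih hσ.pred).smul ((ih hσ.pred).smul hσ.2.2)).neg
    convert h using 3 with i u
    simp only [smul_eq_mul]
    field_simp

section norm

variable {V : Type*} [NormedAddCommGroup V] [InnerProductSpace ℝ V] {p : ι → ℝ → V} {c : ℝ}

/-- The derivative of `‖p‖` is `⟪p, p'⟫ / ‖p‖`: only `p'` carries the weight `d`, while `p` and
`1/‖p‖` enter at orders below `j`, where weight `1` is assumed. The bound is thus linear in the
top-order derivative. -/
theorem norm_of_lt (hc : 0 < c) (hpc : ∀ i u, c ≤ ‖p i u‖)
    (hp : ∀ m < j, UnifBound (fun _ => 1) m p)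
    (hn : ∀ m < j, UnifBound (fun _ => 1) m (fun i u => ‖p i u‖)) (hpd : UnifBound d j p) :
    UnifBound d j (fun i u => ‖p i u‖) := by
  have h0 : ∀ i u, p i u ≠ 0 := fun i u => norm_pos_iff.mp (hc.trans_le (hpc i u))
  cases j with
  | zero => exact ⟨fun i => (hpd.1 i).norm, hpd.2.imp fun C hC i u => by simpa using hC i u⟩
  | succ j =>
    refine of_hasDerivAt (f' := fun i u => (‖p i u‖)⁻¹ • inner ℝ (p i u) (deriv (p i) u))
      (fun i u => ?_) (hpd.2.1.imp fun C hC i u => by simpa using hC i u)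
      (((hn j j.lt_succ_self).inv hc (fun i u => by simpa using hpc i u)).smul
        ((hp j j.lt_succ_self).bilin (innerSL ℝ) hpd.2.2))
    have h1 := ((hpd.hasDerivAt i u).norm_sq).sqrt (pow_ne_zero 2 (norm_ne_zero_iff.mpr (h0 i u)))
    simp only [Real.sqrt_sq (norm_nonneg _)] at h1
    refine h1.congr_deriv ?_
    rw [smul_eq_mul]
    have := norm_ne_zero_iff.mpr (h0 i u)
    field_simp

theorem norm (hc : 0 < c) (hpc : ∀ i u, c ≤ ‖p i u‖) (hp : ∀ m < j, UnifBound (fun _ => 1) m p)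
    (hpd : UnifBound d j p) : UnifBound d j (fun i u => ‖p i u‖) := by
  refine norm_of_lt hc hpc hp (fun m hm => ?_) hpd
  induction m using Nat.strong_induction_on with
  | _ m ih =>
    exact norm_of_lt hc hpc (fun l hl => hp l (hl.trans hm)) (fun l hl => ih l hl (hl.trans hm))
      (hp m hm)

end norm

theorem norm_iteratedDeriv_le (h : UnifBound d j f) (hd : ∀ i, 0 ≤ d i) :
    ∃ C, 0 ≤ C ∧ ∀ i, ∀ m ≤ j, ∀ u, ‖iteratedDeriv m (f i) u‖ ≤ C * d i := by
  induction j generalizing f with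
  | zero =>
    obtain ⟨C, hC⟩ := h.2
    refine ⟨|C|, abs_nonneg C, fun i m hm u => ?_⟩
    rw [Nat.le_zero.mp hm, iteratedDeriv_zero]
    exact (hC i u).trans (mul_le_mul_of_nonneg_right (le_abs_self C) (hd i))
  | succ j ih =>
    obtain ⟨C, hC⟩ := h.bound
    obtain ⟨D, hD0, hD⟩ := ih h.2.2
    refine ⟨max |C| D, le_max_of_le_right hD0, fun i m hm u => ?_⟩
    cases m with
    | zero =>
      rw [iteratedDeriv_zero]
      exact (hC i u).trans (mul_le_mul_of_nonneg_right
        ((le_abs_self C).trans (le_max_left _ _)) (hd i))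
    | succ m =>
      rw [iteratedDeriv_succ']
      exact (hD i m (by omega) u).trans (mul_le_mul_of_nonneg_right (le_max_right _ _) (hd i))

theorem contDiff (h : UnifBound d j f) (i : ι) : ContDiff ℝ j (f i) := by
  induction j generalizing f with
  | zero => exact contDiff_zero.mpr (h.1 i)
  | succ j ih =>
    rw [Nat.cast_succ, contDiff_succ_iff_deriv]
    exact ⟨h.1 i, by simp, ih h.2.2⟩

theorem of_iteratedDeriv (hf : ∀ i, ContDiff ℝ j (f i)) {C : ℝ}
    (hC : ∀ i, ∀ m ≤ j, ∀ u, ‖iteratedDeriv m (f i) u‖ ≤ C * d i) : UnifBound d j f := by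
  induction j generalizing f with
  | zero => exact ⟨fun i => (hf i).continuous, C, fun i u => by simpa using hC i 0 le_rfl u⟩
  | succ j ih =>
    have h := fun i => contDiff_succ_iff_deriv.mp (by simpa using hf i)
    refine ⟨fun i => (h i).1, ⟨C, fun i u => by simpa using hC i 0 (Nat.zero_le _) u⟩,
      ih (fun i => (h i).2.2) fun i m hm u => ?_⟩
    rw [← iteratedDeriv_succ']
    exact hC i (m + 1) (by omega) u

end UnifBound

end UnifBound

/-! ### Periodic solutions of first-order linear equations. -/

section PeriodicODE

variable {ι E : Type*} [NormedAddCommGroup E] [InnerProductSpace ℝ E]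

/-- Maximum principle for periodic solutions of `g' = σ (g - f)`. -/
theorem norm_le_of_periodic_ode {g f : ℝ → E} {σ : ℝ → ℝ} {M : ℝ} (hp : Function.Periodic g 1)
    (hg : ∀ u, HasDerivAt g (σ u • (g u - f u)) u) (hσ : ∀ u, σ u ≠ 0) (hf : ∀ u, ‖f u‖ ≤ M)
    (u : ℝ) : ‖g u‖ ≤ M := by
  have hc : Continuous g := continuous_iff_continuousAt.mpr fun u => (hg u).continuousAt
  obtain ⟨u₀, -, hu₀⟩ := (isCompact_Icc (a := (0 : ℝ)) (b := 1)).exists_isMaxOn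
    (nonempty_Icc.mpr zero_le_one) hc.norm.continuousOn
  have hmax : ∀ v, ‖g v‖ ≤ ‖g u₀‖ := by
    intro v
    obtain ⟨w, hw, hvw⟩ := hp.exists_mem_Ico₀ one_pos v
    rw [hvw]
    exact hu₀ ⟨hw.1, hw.2.le⟩
  refine (hmax u).trans ?_
  have hloc : IsLocalMax (fun v => ‖g v‖ ^ 2) u₀ :=
    Eventually.of_forall fun v => pow_le_pow_left₀ (norm_nonneg _) (hmax v) 2
  -- At the maximum, `σ ≠ 0` forces `|g|² = ⟪g, f⟫`, and Cauchy–Schwarz concludes.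
  have h0 := hloc.hasDerivAt_eq_zero (hg u₀).norm_sq
  rw [real_inner_smul_right, inner_sub_right, real_inner_self_eq_norm_sq] at h0
  have h1 : ‖g u₀‖ ^ 2 = inner ℝ (g u₀) (f u₀) := by
    have := hσ u₀
    have h2 : σ u₀ * (‖g u₀‖ ^ 2 - inner ℝ (g u₀) (f u₀)) = 0 := by linarith
    rcases mul_eq_zero.mp h2 with h | h
    · exact absurd h this
    · linarith
  have h2 := (real_inner_le_norm (g u₀) (f u₀)).trans
    (mul_le_mul_of_nonneg_left (hf u₀) (norm_nonneg _))
  rcases (norm_nonneg (g u₀)).eq_or_lt with h | h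
  · rw [← h]
    exact (norm_nonneg _).trans (hf u₀)
  · rw [← h1, sq] at h2
    exact le_of_mul_le_mul_left h2 h

/-- The maximum principle, with `-h/σ` as the source, bounds `g` itself; all derivatives are then
read off the equation, so `g` is one order smoother than its data. -/
theorem UnifBound.of_periodic_ode {d : ι → ℝ} {j : ℕ} {g h : ι → ℝ → E} {σ : ι → ℝ → ℝ} {c : ℝ}
    (hc : 0 < c) (hp : ∀ i, Function.Periodic (g i) 1)
    (hg : ∀ i u, HasDerivAt (g i) (σ i u • g i u + h i u) u) (hσc : ∀ i u, c ≤ |σ i u|)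
    (hσ : UnifBound (fun _ => 1) j σ) (hh : UnifBound d j h) : UnifBound d (j + 1) g := by
  have h0 : ∀ i u, σ i u ≠ 0 := fun i u => abs_pos.mp (hc.trans_le (hσc i u))
  have hb : ∃ C, ∀ i u, ‖g i u‖ ≤ C * d i := by
    obtain ⟨C, hC⟩ := hh.bound
    refine ⟨c⁻¹ * C, fun i => ?_⟩
    refine norm_le_of_periodic_ode (f := fun u => -((σ i u)⁻¹ • h i u)) (σ := σ i) (hp i)
      (fun u => ?_) (h0 i) fun u => ?_
    · convert hg i u using 1
      rw [sub_neg_eq_add, smul_add, smul_inv_smul₀ (h0 i u)]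
    · rw [norm_neg, norm_smul, norm_inv, mul_assoc]
      exact mul_le_mul (inv_anti₀ hc (hσc i u)) (hC i u) (norm_nonneg _) (by positivity)
  induction j with
  | zero =>
    refine of_hasDerivAt hg hb (UnifBound.add (hσ.smul ⟨fun i => ?_, hb⟩) hh)
    exact continuous_iff_continuousAt.mpr fun u => (hg i u).continuousAt
  | succ j ih => exact of_hasDerivAt hg hb ((hσ.smul (ih hσ.pred hh.pred)).add hh)

/-- The primitive of `σ` vanishing at `0`. -/
def primitive (σ : ℝ → E) (u : ℝ) : E := ∫ v in (0 : ℝ)..u, σ v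

theorem hasDerivAt_primitive [CompleteSpace E] {σ : ℝ → E} (hσ : Continuous σ) (u : ℝ) :
    HasDerivAt (primitive σ) (σ u) u :=
  intervalIntegral.integral_hasDerivAt_right (hσ.intervalIntegrable _ _)
    (hσ.stronglyMeasurableAtFilter _ _) hσ.continuousAt

theorem continuous_primitive [CompleteSpace E] {σ : ℝ → E} (hσ : Continuous σ) : Continuous (primitive σ) :=
  continuous_iff_continuousAt.mpr fun u => (hasDerivAt_primitive hσ u).continuousAt

theorem primitive_add_one {σ : ℝ → E} (hσ : Continuous σ) (u : ℝ) :
    primitive σ (u + 1) = primitive σ 1 + primitive (fun v => σ (v + 1)) u := by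
  unfold primitive
  rw [intervalIntegral.integral_comp_add_right, zero_add,
    intervalIntegral.integral_add_adjacent_intervals] <;>
  exact hσ.intervalIntegrable _ _

/-- The integrated inhomogeneity in the variation of constants formula for `g' = σ (g - f)`. -/
def duhamel (σ : ℝ → ℝ) (f : ℝ → E) : ℝ → E :=
  primitive fun v => (Real.exp (-primitive σ v) * σ v) • f v

/-- The periodic solution of `g' = σ (g - f)`. -/
def perSol (σ : ℝ → ℝ) (f : ℝ → E) (u : ℝ) : E :=
  Real.exp (primitive σ u) •
    ((1 - Real.exp (-primitive σ 1))⁻¹ • duhamel σ f 1 - duhamel σ f u)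

variable {σ : ℝ → ℝ} {f : ℝ → E}

theorem continuous_duhamel_integrand (hσ : Continuous σ) (hf : Continuous f) :
    Continuous fun v => (Real.exp (-primitive σ v) * σ v) • f v :=
  ((Real.continuous_exp.comp (continuous_primitive hσ).neg).mul hσ).smul hf

theorem hasDerivAt_perSol [CompleteSpace E] (hσ : Continuous σ) (hf : Continuous f) (u : ℝ) :
    HasDerivAt (perSol σ f) (σ u • (perSol σ f u - f u)) u := by
  have h1 := (hasDerivAt_primitive hσ u).exp
  have h2 := (hasDerivAt_primitive (continuous_duhamel_integrand hσ hf) u).const_sub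
    ((1 - Real.exp (-primitive σ 1))⁻¹ • duhamel σ f 1)
  have h3 := h1.smul h2
  refine h3.congr_deriv ?_
  have h4 : Real.exp (primitive σ u) * Real.exp (-primitive σ u) = 1 := by
    rw [← Real.exp_add, add_neg_cancel, Real.exp_zero]
  have h5 : Real.exp (primitive σ u) • -((Real.exp (-primitive σ u) * σ u) • f u) =
      -(σ u • f u) := by
    rw [smul_neg, smul_smul, ← mul_assoc, h4, one_mul]
  rw [h5, perSol, duhamel]
  module

/-- The constant `(1 - e^{-S(1)})⁻¹ • duhamel σ f 1` in `perSol`, with `S = primitive σ`, is the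
initial value to which the solution returns after one period; it makes sense because `S(1) ≠ 0`. -/
theorem periodic_perSol (hσ : Continuous σ) (hf : Continuous f) (hσp : Function.Periodic σ 1)
    (hfp : Function.Periodic f 1) (h1 : primitive σ 1 ≠ 0) :
    Function.Periodic (perSol σ f) 1 := by
  intro u
  have hS : ∀ u, primitive σ (u + 1) = primitive σ 1 + primitive σ u := fun u => by
    rw [primitive_add_one hσ, show (fun v => σ (v + 1)) = σ from funext hσp]
  have hQ : duhamel σ f (u + 1) = duhamel σ f 1 + Real.exp (-primitive σ 1) • duhamel σ f u := by
    unfold duhamel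
    rw [primitive_add_one (continuous_duhamel_integrand hσ hf)]
    congr 1
    unfold primitive
    rw [← intervalIntegral.integral_smul]
    refine intervalIntegral.integral_congr fun v _ => ?_
    have := hS v
    unfold primitive at this
    simp only [this, hσp v, hfp v, neg_add, Real.exp_add, smul_smul, mul_assoc]
  have hne : (1 : ℝ) - Real.exp (-primitive σ 1) ≠ 0 := by
    rw [sub_ne_zero, ne_comm, Ne, Real.exp_eq_one_iff]
    simpa using h1
  unfold perSol
  rw [hS, hQ, Real.exp_add, mul_comm, mul_smul]
  congr 1
  set a := Real.exp (-primitive σ 1) with ha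
  have hb : Real.exp (primitive σ 1) = a⁻¹ := by rw [ha, Real.exp_neg, inv_inv]
  have ha0 : a ≠ 0 := (Real.exp_pos _).ne'
  rw [hb, smul_sub, smul_add, smul_smul a⁻¹ a, inv_mul_cancel₀ ha0, smul_smul, one_smul,
    sub_add_eq_sub_sub, ← sub_smul]
  congr 2
  field_simp
  ring

end PeriodicODE

/-! ### The Banach space `C^k(S¹, ℝ²)`. -/

namespace CkLoop

variable {k : ℕ}

/-- A `C^k` periodic map, as an element of `C^k(S¹, ℝ²)`. -/
def ofMem (f : ℝ → Plane) (hf : f ∈ loopSubmodule k) : CkLoop k := ⟨f, hf⟩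

theorem norm_le_iff {x : CkLoop k} {M : ℝ} (hM : 0 ≤ M) :
    ‖x‖ ≤ M ↔ ∀ j ≤ k, ∀ u, ‖iteratedDeriv j x u‖ ≤ M := by
  change ‖jet k x‖ ≤ M ↔ _
  rw [pi_norm_le_iff_of_nonneg hM]
  constructor
  · intro h j hj u
    exact (BoundedContinuousFunction.norm_le hM).mp (h ⟨j, Nat.lt_succ_of_le hj⟩) u
  · exact fun h j => (BoundedContinuousFunction.norm_le hM).mpr
      fun u => h j (Nat.lt_succ_iff.mp j.2) u

theorem norm_iteratedDeriv_le (x : CkLoop k) {j : ℕ} (hj : j ≤ k) (u : ℝ) :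
    ‖iteratedDeriv j x u‖ ≤ ‖x‖ := (norm_le_iff (norm_nonneg x)).mp le_rfl j hj u

theorem norm_apply_le (x : CkLoop k) (u : ℝ) : ‖x u‖ ≤ ‖x‖ := by
  simpa using x.norm_iteratedDeriv_le (Nat.zero_le k) u

theorem norm_deriv_le (hk : 1 ≤ k) (x : CkLoop k) (u : ℝ) : ‖deriv x u‖ ≤ ‖x‖ := by
  simpa using x.norm_iteratedDeriv_le hk u

/-- Evaluation of the derivative of order `j` at a point. -/
def evalDeriv (k : ℕ) (j : ℕ) (hj : j ≤ k) (u : ℝ) : CkLoop k →L[ℝ] Plane :=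
  LinearMap.mkContinuous
    { toFun := fun x => iteratedDeriv j x u
      map_add' := fun x y => DFunLike.congr_fun
        (congrFun ((jet k).map_add x y) ⟨j, Nat.lt_succ_of_le hj⟩) u
      map_smul' := fun c x => DFunLike.congr_fun
        (congrFun ((jet k).map_smul c x) ⟨j, Nat.lt_succ_of_le hj⟩) u } 1
    fun x => by
      rw [one_mul]
      exact x.norm_iteratedDeriv_le hj u

theorem evalDeriv_apply {j : ℕ} (hj : j ≤ k) (u : ℝ) (x : CkLoop k) :
    evalDeriv k j hj u x = iteratedDeriv j x u := rfl

theorem evalDeriv_zero (u : ℝ) (x : CkLoop k) : evalDeriv k 0 (Nat.zero_le k) u x = x u := by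
  rw [evalDeriv_apply, iteratedDeriv_zero]

theorem evalDeriv_one (hk : 1 ≤ k) (u : ℝ) (x : CkLoop k) :
    evalDeriv k 1 hk u x = deriv x u := by
  rw [evalDeriv_apply, iteratedDeriv_one]

theorem sub_apply (x y : CkLoop k) (u : ℝ) : (x - y) u = x u - y u := rfl

/-- The inclusion of `C^k` into `C^m` for `m ≤ k`. -/
def incl (k m : ℕ) (h : m ≤ k) : CkLoop k →L[ℝ] CkLoop m :=
  LinearMap.mkContinuous
    { toFun := fun x => ⟨x, x.contDiff.of_le (by exact_mod_cast h), x.periodic⟩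
      map_add' := fun _ _ => rfl
      map_smul' := fun _ _ => rfl } 1
    fun x => by
      rw [one_mul]
      exact (norm_le_iff (norm_nonneg x)).mpr fun j hj u => x.norm_iteratedDeriv_le (hj.trans h) u

theorem isometry_jet (k : ℕ) : Isometry (jet k) := Isometry.of_dist_eq fun x y => by
  rw [dist_eq_norm, dist_eq_norm, ← map_sub]
  rfl

/-- Uniform limits of the derivatives are the derivatives of the limit, so a limit of jets is again
a jet. -/
instance : CompleteSpace (CkLoop k) := by
  refine Metric.complete_of_cauchySeq_tendsto fun x hx => ?_
  obtain ⟨G, hG⟩ := cauchySeq_tendsto_of_complete ((isometry_jet k).uniformContinuous.comp_cauchySeq hx)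
  have hGj : ∀ j, TendstoUniformly (fun n => ⇑(jet k (x n) j)) (G j) atTop := fun j =>
    BoundedContinuousFunction.tendsto_iff_tendstoUniformly.mp (tendsto_pi_nhds.mp hG j)
  have hder : ∀ j (hj : j + 1 < k + 1) u,
      HasDerivAt (G ⟨j, by omega⟩) (G ⟨j + 1, hj⟩ u) u := by
    intro j hj
    refine hasDerivAt_of_tendstoUniformly (hGj ⟨j + 1, hj⟩)
      (Eventually.of_forall fun n u => ?_) fun u => (hGj ⟨j, by omega⟩).tendsto_at u
    have h1 := (contDiff_nat_iff_iteratedDeriv.mp (x n).contDiff).2 j (by omega)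
    change HasDerivAt (iteratedDeriv j (x n)) (iteratedDeriv (j + 1) (x n) u) u
    rw [iteratedDeriv_succ]
    exact (h1 u).hasDerivAt
  have hit : ∀ j (hj : j < k + 1), iteratedDeriv j (G 0) = G ⟨j, hj⟩ := by
    intro j
    induction j with
    | zero => exact fun _ => iteratedDeriv_zero
    | succ j ih =>
      intro hj
      rw [iteratedDeriv_succ, ih (by omega)]
      exact funext fun u => (hder j hj u).deriv
  have hcd : ContDiff ℝ k (G 0) := by
    refine contDiff_nat_iff_iteratedDeriv.mpr ⟨fun m hm => ?_, fun m hm => ?_⟩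
    · rw [hit m (by omega)]
      exact (G _).continuous
    · rw [hit m (by omega)]
      exact fun u => (hder m (by omega) u).differentiableAt
  have hper : Function.Periodic (G 0) 1 := by
    intro u
    refine tendsto_nhds_unique ((hGj 0).tendsto_at (u + 1)) (((hGj 0).tendsto_at u).congr fun n => ?_)
    simpa [jet_apply] using ((x n).periodic u).symm
  refine ⟨⟨G 0, hcd, hper⟩, (isometry_jet k).isUniformInducing.isInducing.tendsto_nhds_iff.mpr ?_⟩
  convert hG using 2
  funext j
  ext1 u
  exact congrFun (hit j j.2) u

theorem periodic_deriv (x : CkLoop k) : Function.Periodic (deriv x) 1 := by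
  simpa using x.iteratedDeriv_periodic 1

theorem continuous_deriv (hk : 1 ≤ k) (x : CkLoop k) : Continuous (deriv x) :=
  x.contDiff.continuous_deriv (by exact_mod_cast hk)

theorem continuous (x : CkLoop k) : Continuous x := x.contDiff.continuous

theorem hasDerivAt (hk : 1 ≤ k) (x : CkLoop k) (u : ℝ) : HasDerivAt x (deriv x u) u :=
  (x.contDiff.differentiable (by
    exact_mod_cast (Nat.one_le_iff_ne_zero.mp hk)) u).hasDerivAt

theorem unifBound {ι : Type*} {d : ι → ℝ} {x : ι → CkLoop k} {C : ℝ} (h : ∀ i, ‖x i‖ ≤ C * d i) :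
    UnifBound d k (fun i => (x i : ℝ → Plane)) :=
  .of_iteratedDeriv (fun i => (x i).contDiff)
    fun i _ hm u => ((x i).norm_iteratedDeriv_le hm u).trans (h i)

theorem norm_le_of_unifBound {ι : Type*} {d : ι → ℝ} {x : ι → CkLoop k} (hd : ∀ i, 0 ≤ d i)
    (h : UnifBound d k (fun i => (x i : ℝ → Plane))) : ∃ C, 0 ≤ C ∧ ∀ i, ‖x i‖ ≤ C * d i := by
  obtain ⟨C, hC0, hC⟩ := h.norm_iteratedDeriv_le hd
  exact ⟨C, hC0, fun i => (norm_le_iff (mul_nonneg hC0 (hd i))).mpr (hC i)⟩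

end CkLoop

/-! ### The resolvent of `1 - ∂ₛ²` and its pointwise bounds. -/

section Resolvent

variable {ι : Type*} {k m : ℕ}

/-- The periodic solution of `g' = ε |x'| (g - x / 2)`; for `ε = ± 1` the two first-order factors of
`(1 - ∂ₛ²)⁻¹ x`. -/
def halfResolvent (ε : ℝ) (x : ℝ → Plane) : ℝ → Plane :=
  perSol (fun u => ε * ‖deriv x u‖) (fun u => (2 : ℝ)⁻¹ • x u)

/-- The periodic solution `y` of `y - y_ss = x`. -/
def resolvent (x : ℝ → Plane) (u : ℝ) : Plane := halfResolvent 1 x u + halfResolvent (-1) x u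

/-- The arc length derivative of the resolvent. -/
def resolventDeriv (x : ℝ → Plane) (u : ℝ) : Plane := halfResolvent 1 x u - halfResolvent (-1) x u

theorem exists_le_norm_deriv (hk : 1 ≤ k) {x : CkLoop k} (hx : x ∈ Imm k) :
    ∃ c, 0 < c ∧ ∀ u, c ≤ ‖deriv x u‖ := by
  obtain ⟨u₀, -, hu₀⟩ := (isCompact_Icc (a := (0 : ℝ)) (b := 1)).exists_isMinOn
    (nonempty_Icc.mpr zero_le_one) (x.continuous_deriv hk).norm.continuousOn
  refine ⟨‖deriv x u₀‖, norm_pos_iff.mpr (hx u₀), fun u => ?_⟩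
  obtain ⟨w, hw, hvw⟩ := x.periodic_deriv.exists_mem_Ico₀ one_pos u
  rw [hvw]
  exact hu₀ ⟨hw.1, hw.2.le⟩

theorem length_pos (hk : 1 ≤ k) {x : CkLoop k} (hx : x ∈ Imm k) : 0 < length x :=
  intervalIntegral.intervalIntegral_pos_of_pos_on
    ((x.continuous_deriv hk).norm.intervalIntegrable _ _)
    (fun u _ => norm_pos_iff.mpr (hx u)) one_pos

theorem primitive_smul_speed (ε : ℝ) (x : ℝ → Plane) (u : ℝ) :
    primitive (fun u => ε * ‖deriv x u‖) u = ε * arcLength x u :=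
  intervalIntegral.integral_const_mul _ _

section

variable {ε : ℝ} {x : CkLoop k}

theorem hasDerivAt_halfResolvent (ε : ℝ) (hk : 1 ≤ k) (x : CkLoop k) (u : ℝ) :
    HasDerivAt (halfResolvent ε x)
      ((ε * ‖deriv x u‖) • (halfResolvent ε x u - (2 : ℝ)⁻¹ • x u)) u :=
  hasDerivAt_perSol (continuous_const.mul (x.continuous_deriv hk).norm)
    (x.continuous.const_smul (2 : ℝ)⁻¹) u

theorem periodic_halfResolvent (hε : ε ≠ 0) (hk : 1 ≤ k) (hx : x ∈ Imm k) :
    Function.Periodic (halfResolvent ε x) 1 := by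
  refine periodic_perSol (continuous_const.mul (x.continuous_deriv hk).norm)
    (x.continuous.const_smul (2 : ℝ)⁻¹) (fun u => ?_) (fun u => ?_) ?_
  · simp only [x.periodic_deriv u]
  · simp only [x.periodic u]
  · rw [primitive_smul_speed]
    exact mul_ne_zero hε (length_pos hk hx).ne'

theorem periodic_resolvent (hk : 1 ≤ k) (hx : x ∈ Imm k) : Function.Periodic (resolvent x) 1 :=
  (periodic_halfResolvent one_ne_zero hk hx).add
    (periodic_halfResolvent (neg_ne_zero.mpr one_ne_zero) hk hx)

theorem periodic_resolventDeriv (hk : 1 ≤ k) (hx : x ∈ Imm k) :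
    Function.Periodic (resolventDeriv x) 1 :=
  (periodic_halfResolvent one_ne_zero hk hx).sub
    (periodic_halfResolvent (neg_ne_zero.mpr one_ne_zero) hk hx)

theorem hasDerivAt_resolvent (hk : 1 ≤ k) (x : CkLoop k) (u : ℝ) :
    HasDerivAt (resolvent x) (‖deriv x u‖ • resolventDeriv x u) u := by
  refine ((hasDerivAt_halfResolvent 1 hk x u).add
    (hasDerivAt_halfResolvent (-1) hk x u)).congr_deriv ?_
  rw [resolventDeriv]
  module

theorem hasDerivAt_resolventDeriv (hk : 1 ≤ k) (x : CkLoop k) (u : ℝ) :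
    HasDerivAt (resolventDeriv x) (‖deriv x u‖ • (resolvent x u - x u)) u := by
  refine ((hasDerivAt_halfResolvent 1 hk x u).sub
    (hasDerivAt_halfResolvent (-1) hk x u)).congr_deriv ?_
  rw [resolvent]
  module

/-- The resolvent fixes constants, so the maximum principle applies to each half with `x - a` in
place of `x`. The choice `a = 0` gives `|y| ≤ ‖x‖`; `a = x u` gives `|y - x| ≤ L/2`. -/
theorem norm_resolvent_sub_le (hk : 1 ≤ k) (hx : x ∈ Imm k) {a : Plane} {M : ℝ}
    (hM : ∀ u, ‖x u - a‖ ≤ M) (u : ℝ) : ‖resolvent x u - a‖ ≤ M := by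
  have key : ∀ ε : ℝ, ε ≠ 0 → ‖halfResolvent ε x u - (2 : ℝ)⁻¹ • a‖ ≤ 2⁻¹ * M := by
    intro ε hε
    refine norm_le_of_periodic_ode (g := fun u => halfResolvent ε x u - (2 : ℝ)⁻¹ • a)
      (f := fun u => (2 : ℝ)⁻¹ • (x u - a)) (σ := fun u => ε * ‖deriv x u‖) (fun u => ?_)
      (fun u => ?_) (fun u => mul_ne_zero hε (norm_ne_zero_iff.mpr (hx u))) (fun u => ?_) u
    · simp only [periodic_halfResolvent hε hk hx u]
    · refine ((hasDerivAt_halfResolvent ε hk x u).sub_const _).congr_deriv ?_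
      module
    · rw [norm_smul, norm_inv, Real.norm_ofNat]
      exact mul_le_mul_of_nonneg_left (hM u) (by norm_num)
  have h : resolvent x u - a = (halfResolvent 1 x u - (2 : ℝ)⁻¹ • a) +
      (halfResolvent (-1) x u - (2 : ℝ)⁻¹ • a) := by
    rw [resolvent]
    module
  rw [h]
  refine (norm_add_le _ _).trans ?_
  linarith [key 1 one_ne_zero, key (-1) (neg_ne_zero.mpr one_ne_zero)]

theorem norm_resolvent_le (hk : 1 ≤ k) (hx : x ∈ Imm k) (u : ℝ) : ‖resolvent x u‖ ≤ ‖x‖ := by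
  simpa using norm_resolvent_sub_le hk hx (a := 0) (M := ‖x‖)
    (fun v => by simpa using x.norm_apply_le v) u

/-- For `ε = ±1`, `g = (w + ε (y - x)) / 2` solves `g_s = ε (g - T/2)` with `T` the unit tangent, so
`|g| ≤ 1/2`; the two functions `g` add up to `w`. -/
theorem norm_resolventDeriv_le_one (hk : 1 ≤ k) (hx : x ∈ Imm k) (u : ℝ) :
    ‖resolventDeriv x u‖ ≤ 1 := by
  have key : ∀ ε : ℝ, ε ≠ 0 → ε * ε = 1 →
      ‖(2 : ℝ)⁻¹ • (resolventDeriv x u + ε • (resolvent x u - x u))‖ ≤ 2⁻¹ := by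
    intro ε hε hε2
    refine norm_le_of_periodic_ode
      (g := fun u => (2 : ℝ)⁻¹ • (resolventDeriv x u + ε • (resolvent x u - x u)))
      (f := fun u => (2 : ℝ)⁻¹ • ‖deriv x u‖⁻¹ • deriv x u) (σ := fun u => ε * ‖deriv x u‖)
      (fun u => ?_)
      (fun u => ?_) (fun u => mul_ne_zero hε (norm_ne_zero_iff.mpr (hx u))) (fun u => ?_) u
    · simp only [periodic_resolventDeriv hk hx u, periodic_resolvent hk hx u, x.periodic u]
    · have h1 := (((hasDerivAt_resolventDeriv hk x u).add
        (((hasDerivAt_resolvent hk x u).sub (x.hasDerivAt hk u)).const_smul ε)).const_smul (2 : ℝ)⁻¹)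
      refine h1.congr_deriv ?_
      have h2 : (ε * ‖deriv x u‖) • (2 : ℝ)⁻¹ • ‖deriv x u‖⁻¹ • deriv x u =
          (ε * (2 : ℝ)⁻¹) • deriv x u := by
        have := norm_ne_zero_iff.mpr (hx u)
        rw [smul_smul, smul_smul]
        congr 1
        field_simp
      rw [smul_sub (ε * _), h2]
      match_scalars
      · linear_combination (-2⁻¹ * ‖deriv x u‖) * hε2
      · linear_combination (2⁻¹ * ‖deriv x u‖) * hε2
      · ring
      · ring
    · rw [norm_smul, norm_smul, norm_inv, norm_inv, norm_norm,
        inv_mul_cancel₀ (norm_ne_zero_iff.mpr (hx u)), Real.norm_ofNat, mul_one]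
  have h : resolventDeriv x u =
      (2 : ℝ)⁻¹ • (resolventDeriv x u + (1 : ℝ) • (resolvent x u - x u)) +
      (2 : ℝ)⁻¹ • (resolventDeriv x u + (-1 : ℝ) • (resolvent x u - x u)) := by
    module
  rw [h]
  refine (norm_add_le _ _).trans ?_
  linarith [key 1 one_ne_zero (by norm_num), key (-1) (neg_ne_zero.mpr one_ne_zero) (by norm_num)]

/-- Splitting the Green integral at `v = u` removes the absolute value. Each `cosh` then splits into
exponentials of `±s(v)`, whose integrals are the Duhamel integrals of the two half resolvents. What
remains is a rational identity in `p = e^{L/2}` and `S = e^{s(u)}`. -/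
theorem velocity_eq (hk : 1 ≤ k) (hx : x ∈ Imm k) {u : ℝ} (hu : u ∈ Icc (0 : ℝ) 1) :
    velocity x u = resolvent x u - x u := by
  have hL := length_pos hk hx
  have hρ : Continuous fun v => ‖deriv x v‖ := (x.continuous_deriv hk).norm
  have hs : Continuous (arcLength x) := continuous_primitive hρ
  have hmono : Monotone (arcLength x) :=
    monotone_of_hasDerivAt_nonneg (hasDerivAt_primitive hρ) fun v => norm_nonneg _
  have hσ : ∀ ε : ℝ, Continuous fun v => ε * ‖deriv x v‖ := fun ε => continuous_const.mul hρ
  set I : ℝ → ℝ → Plane := fun ε v =>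
    (Real.exp (-primitive (fun u => ε * ‖deriv x u‖) v) * (ε * ‖deriv x v‖)) • (2 : ℝ)⁻¹ • x v
    with hI
  have hIc : ∀ ε, Continuous (I ε) := fun ε =>
    continuous_duhamel_integrand (hσ ε) (x.continuous.const_smul (2 : ℝ)⁻¹)
  have hIi : ∀ ε a b, IntervalIntegrable (I ε) MeasureTheory.volume a b :=
    fun ε a b => (hIc ε).intervalIntegrable a b
  set D : ℝ → ℝ → Plane := fun ε => primitive (I ε) with hD
  have hI1 : ∀ v, I 1 v = ((Real.exp (arcLength x v))⁻¹ * ‖deriv x v‖) • (2 : ℝ)⁻¹ • x v := by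
    intro v
    simp only [hI, primitive_smul_speed, one_mul, Real.exp_neg]
  have hI2 : ∀ v, I (-1) v = -(Real.exp (arcLength x v) * ‖deriv x v‖) • (2 : ℝ)⁻¹ • x v := by
    intro v
    simp only [hI, primitive_smul_speed, neg_mul, one_mul, neg_neg, mul_neg]
  set p := Real.exp (length x / 2) with hp
  have hp0 : 0 < p := Real.exp_pos _
  have hp1 : 1 < p := Real.one_lt_exp_iff.mpr (by linarith)
  have hsinh : 2 * Real.sinh (-(length x / 2)) = p⁻¹ - p := by
    rw [Real.sinh_eq, neg_neg, Real.exp_neg]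
    ring
  set S := Real.exp (arcLength x u) with hS
  have hS0 : 0 < S := Real.exp_pos _
  have hcosh : ∀ r, Real.cosh (r - length x / 2) =
      (Real.exp r * p⁻¹ + (Real.exp r)⁻¹ * p) / 2 := by
    intro r
    rw [Real.cosh_eq, neg_sub, Real.exp_sub, Real.exp_sub, ← hp]
    simp only [div_eq_mul_inv, mul_comm p]
  have hlow : ∀ v ∈ uIcc 0 u, (green x u v * ‖deriv x v‖) • x v =
      (S * p⁻¹ / (p⁻¹ - p)) • I 1 v - (S⁻¹ * p / (p⁻¹ - p)) • I (-1) v := by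
    intro v hv
    rw [uIcc_of_le hu.1] at hv
    rw [green, hsinh, abs_of_nonneg (sub_nonneg.mpr (hmono hv.2)), hcosh, hI1, hI2, Real.exp_sub,
      ← hS]
    have hv0 := Real.exp_pos (arcLength x v)
    match_scalars
    field_simp
    ring
  have hhigh : ∀ v ∈ uIcc u 1, (green x u v * ‖deriv x v‖) • x v =
      (S * p / (p⁻¹ - p)) • I 1 v - (S⁻¹ * p⁻¹ / (p⁻¹ - p)) • I (-1) v := by
    intro v hv
    rw [uIcc_of_le hu.2] at hv
    rw [green, hsinh, abs_of_nonpos (sub_nonpos.mpr (hmono hv.1)), hcosh, hI1, hI2, neg_sub,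
      Real.exp_sub, ← hS]
    have hv0 := Real.exp_pos (arcLength x v)
    match_scalars
    field_simp
    ring
  have hgc : Continuous fun v => (green x u v * ‖deriv x v‖) • x v := by
    unfold green
    refine Continuous.smul (Continuous.mul (Continuous.div_const ?_ _) hρ) x.continuous
    exact Real.continuous_cosh.comp (((continuous_const.sub hs).abs).sub continuous_const)
  have hsub : ∀ ε, (∫ v in u..1, I ε v) = D ε 1 - D ε u := fun ε =>
    (intervalIntegral.integral_interval_sub_left (hIi ε 0 1) (hIi ε 0 u)).symm
  have hsub0 : ∀ ε, (∫ v in (0 : ℝ)..u, I ε v) = D ε u := fun ε => rfl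
  have hlin : ∀ a b r q : ℝ, (∫ v in a..b, (r • I 1 v - q • I (-1) v)) =
      r • (∫ v in a..b, I 1 v) - q • ∫ v in a..b, I (-1) v := by
    intro a b r q
    rw [← intervalIntegral.integral_smul, ← intervalIntegral.integral_smul]
    exact intervalIntegral.integral_sub ((hIi _ _ _).smul r) ((hIi _ _ _).smul q)
  have hint : (∫ v in (0 : ℝ)..1, (green x u v * ‖deriv x v‖) • x v) =
      ((S * p⁻¹ / (p⁻¹ - p)) • D 1 u - (S⁻¹ * p / (p⁻¹ - p)) • D (-1) u) +
      ((S * p / (p⁻¹ - p)) • (D 1 1 - D 1 u) -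
        (S⁻¹ * p⁻¹ / (p⁻¹ - p)) • (D (-1) 1 - D (-1) u)) := by
    rw [← intervalIntegral.integral_add_adjacent_intervals (hgc.intervalIntegrable 0 u)
      (hgc.intervalIntegrable u 1), intervalIntegral.integral_congr hlow,
      intervalIntegral.integral_congr hhigh, hlin, hlin, hsub, hsub,
      hsub0, hsub0]
  have hhalf : ∀ ε, halfResolvent ε x u = Real.exp (ε * arcLength x u) •
      ((1 - Real.exp (-(ε * length x)))⁻¹ • D ε 1 - D ε u) := by
    intro ε
    rw [← primitive_smul_speed, length, ← primitive_smul_speed]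
    rfl
  have hpp : Real.exp (length x) = p * p := by
    rw [hp, ← Real.exp_add]
    congr 1
    ring
  rw [velocity, hint, resolvent, hhalf, hhalf]
  simp only [one_mul, neg_mul, neg_neg, Real.exp_neg, hpp, ← hS]
  have hq : 1 - p ^ 2 ≠ 0 := by nlinarith
  have e1 : p⁻¹ - p = p⁻¹ * (1 - p ^ 2) := by field_simp
  have e2 : 1 - (p * p)⁻¹ = -(p * p)⁻¹ * (1 - p ^ 2) := by field_simp; ring
  rw [e1, e2]
  match_scalars <;> field_simp <;> ring

end

end Resolvent

/-! ### Regularity and growth of the vector field on `C^k`. -/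

section Field

variable {ι : Type*} {k m : ℕ}

section Families

variable {x y : ι → CkLoop (m + 1)} {c : ℝ} {d : ι → ℝ}

theorem unifBound_speed (hc : 0 < c) (hxc : ∀ i u, c ≤ ‖deriv (x i) u‖)
    (hx : UnifBound (fun _ => 1) m (fun i => deriv (x i)))
    (hxd : UnifBound d m (fun i => deriv (x i))) :
    UnifBound d m (fun i u => ‖deriv (x i) u‖) :=
  UnifBound.norm hc hxc (fun _ h => hx.mono h.le) hxd

theorem abs_smul_speed_ge {ε : ℝ} (hxc : ∀ i u, c ≤ ‖deriv (x i) u‖) (i : ι) (u : ℝ) :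
    |ε| * c ≤ |ε * ‖deriv (x i) u‖| := by
  rw [abs_mul, abs_norm]
  exact mul_le_mul_of_nonneg_left (hxc i u) (abs_nonneg ε)

theorem mem_imm_of_le {k : ℕ} {x : CkLoop k} (hc : 0 < c) (hx : ∀ u, c ≤ ‖deriv x u‖) : x ∈ Imm k :=
  fun u => norm_pos_iff.mp (hc.trans_le (hx u))

theorem unifBound_halfResolvent {ε : ℝ} (hε : ε ≠ 0) (hc : 0 < c)
    (hxc : ∀ i u, c ≤ ‖deriv (x i) u‖)
    (hx : UnifBound (fun _ => 1) (m + 1) (fun i => (x i : ℝ → Plane))) :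
    UnifBound (fun _ => 1) (m + 1) (fun i => halfResolvent ε (x i)) := by
  have hσ : UnifBound (fun _ => 1) m (fun i u => ε * ‖deriv (x i) u‖) :=
    (unifBound_speed hc hxc hx.2.2 hx.2.2).const_smul ε
  refine UnifBound.of_periodic_ode (c := |ε| * c) (σ := fun i u => ε * ‖deriv (x i) u‖)
    (h := fun i u => -((ε * ‖deriv (x i) u‖) • (2 : ℝ)⁻¹ • x i u)) (by positivity)
    (fun i => periodic_halfResolvent hε (Nat.le_add_left 1 m) (mem_imm_of_le hc (hxc i)))
    (fun i u => ?_) (abs_smul_speed_ge hxc) hσ (hσ.smul (hx.pred.const_smul _)).neg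
  refine (hasDerivAt_halfResolvent ε (Nat.le_add_left 1 m) (x i) u).congr_deriv ?_
  module

/-- By `|p| - |q| = ⟪p + q, p - q⟫ / (|p| + |q|)`, the difference is linear in `p - q`, with a
denominator bounded below. -/
theorem unifBound_speed_sub (hc : 0 < c) (hxc : ∀ i u, c ≤ ‖deriv (x i) u‖)
    (hyc : ∀ i u, c ≤ ‖deriv (y i) u‖)
    (hx : UnifBound (fun _ => 1) m (fun i => deriv (x i)))
    (hy : UnifBound (fun _ => 1) m (fun i => deriv (y i)))
    (hxy : UnifBound d m (fun i u => deriv (x i) u - deriv (y i) u)) :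
    UnifBound d m (fun i u => ‖deriv (x i) u‖ - ‖deriv (y i) u‖) := by
  have h := (UnifBound.inv hc ((unifBound_speed hc hxc hx hx).add (unifBound_speed hc hyc hy hy))
    (fun i u => ?_)).smul ((hx.add hy).bilin (innerSL ℝ) hxy)
  · convert h using 3 with i u
    have h0 : 0 < ‖deriv (x i) u‖ + ‖deriv (y i) u‖ := by linarith [hxc i u, hyc i u]
    rw [innerSL_apply_apply, smul_eq_mul, eq_inv_mul_iff_mul_eq₀ h0.ne', inner_add_left,
      inner_sub_right, inner_sub_right, real_inner_self_eq_norm_sq, real_inner_self_eq_norm_sq,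
      real_inner_comm]
    ring
  · rw [abs_of_nonneg (by positivity)]
    linarith [hxc i u, norm_nonneg (deriv (y i) u)]

/-- The difference solves an equation of the same kind, with the coefficient of `x` and a source
linear in `|x'| - |y'|` and `x - y`. The order lost in the speeds is regained from the equation. -/
theorem unifBound_halfResolvent_sub {ε : ℝ} (hε : ε ≠ 0) (hc : 0 < c)
    (hxc : ∀ i u, c ≤ ‖deriv (x i) u‖) (hyc : ∀ i u, c ≤ ‖deriv (y i) u‖)
    (hx : UnifBound (fun _ => 1) (m + 1) (fun i => (x i : ℝ → Plane)))
    (hy : UnifBound (fun _ => 1) (m + 1) (fun i => (y i : ℝ → Plane)))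
    (hxy : UnifBound d (m + 1) (fun i u => x i u - y i u)) :
    UnifBound d (m + 1) (fun i u => halfResolvent ε (x i) u - halfResolvent ε (y i) u) := by
  have h1 := Nat.le_add_left 1 m
  have hσ : UnifBound (fun _ => 1) m (fun i u => ε * ‖deriv (x i) u‖) :=
    (unifBound_speed hc hxc hx.2.2 hx.2.2).const_smul ε
  have hd : UnifBound d m (fun i u => deriv (x i) u - deriv (y i) u) := by
    convert hxy.2.2 using 3 with i u
    exact (((x i).hasDerivAt h1 u).sub ((y i).hasDerivAt h1 u)).deriv.symm
  have hσd : UnifBound d m (fun i u => ε * (‖deriv (x i) u‖ - ‖deriv (y i) u‖)) :=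
    (unifBound_speed_sub hc hxc hyc hx.2.2 hy.2.2 hd).const_smul ε
  refine UnifBound.of_periodic_ode (c := |ε| * c) (σ := fun i u => ε * ‖deriv (x i) u‖)
    (h := fun i u => (ε * (‖deriv (x i) u‖ - ‖deriv (y i) u‖)) •
      (halfResolvent ε (y i) u - (2 : ℝ)⁻¹ • y i u) -
      (ε * ‖deriv (x i) u‖) • (2 : ℝ)⁻¹ • (x i u - y i u)) (by positivity)
    (fun i => (periodic_halfResolvent hε h1 (mem_imm_of_le hc (hxc i))).sub
      (periodic_halfResolvent hε h1 (mem_imm_of_le hc (hyc i))))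
    (fun i u => ?_) (abs_smul_speed_ge hxc) hσ
    ((hσd.smul' ((unifBound_halfResolvent hε hc hyc hy).pred.sub (hy.pred.const_smul _))).sub
      (hσ.smul (hxy.pred.const_smul _)))
  refine ((hasDerivAt_halfResolvent ε h1 (x i) u).sub
    (hasDerivAt_halfResolvent ε h1 (y i) u)).congr_deriv ?_
  module

theorem unifBound_resolvent (hc : 0 < c) (hxc : ∀ i u, c ≤ ‖deriv (x i) u‖)
    (hx : UnifBound (fun _ => 1) (m + 1) (fun i => (x i : ℝ → Plane))) :
    UnifBound (fun _ => 1) (m + 1) (fun i => resolvent (x i)) :=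
  (unifBound_halfResolvent one_ne_zero hc hxc hx).add
    (unifBound_halfResolvent (neg_ne_zero.mpr one_ne_zero) hc hxc hx)

theorem unifBound_resolventDeriv (hc : 0 < c) (hxc : ∀ i u, c ≤ ‖deriv (x i) u‖)
    (hx : UnifBound (fun _ => 1) (m + 1) (fun i => (x i : ℝ → Plane))) :
    UnifBound (fun _ => 1) (m + 1) (fun i => resolventDeriv (x i)) :=
  (unifBound_halfResolvent one_ne_zero hc hxc hx).sub
    (unifBound_halfResolvent (neg_ne_zero.mpr one_ne_zero) hc hxc hx)

theorem unifBound_resolvent_sub (hc : 0 < c)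
    (hxc : ∀ i u, c ≤ ‖deriv (x i) u‖) (hyc : ∀ i u, c ≤ ‖deriv (y i) u‖)
    (hx : UnifBound (fun _ => 1) (m + 1) (fun i => (x i : ℝ → Plane)))
    (hy : UnifBound (fun _ => 1) (m + 1) (fun i => (y i : ℝ → Plane)))
    (hxy : UnifBound d (m + 1) (fun i u => x i u - y i u)) :
    UnifBound d (m + 1) (fun i u => resolvent (x i) u - resolvent (y i) u) := by
  convert (unifBound_halfResolvent_sub one_ne_zero hc hxc hyc hx hy hxy).add
    (unifBound_halfResolvent_sub (neg_ne_zero.mpr one_ne_zero) hc hxc hyc hx hy hxy) using 3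
  simp only [resolvent]
  abel

end Families

theorem resolvent_mem_loopSubmodule (hk : 1 ≤ k) {x : CkLoop k} (hx : x ∈ Imm k) :
    resolvent x ∈ loopSubmodule k := by
  obtain ⟨m, rfl⟩ : ∃ m, k = m + 1 := ⟨k - 1, by omega⟩
  obtain ⟨c, hc, hxc⟩ := exists_le_norm_deriv hk hx
  have h := unifBound_resolvent (ι := Unit) (x := fun _ => x) hc (fun _ => hxc)
    (CkLoop.unifBound (C := ‖x‖) fun _ => by simp)
  exact ⟨h.contDiff (), periodic_resolvent hk hx⟩

open Classical in
/-- The vector field of the flow, on immersions. -/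
def field (x : CkLoop k) : CkLoop k :=
  if h : resolvent x ∈ loopSubmodule k then CkLoop.ofMem (resolvent x) h - x else 0

theorem field_apply (hk : 1 ≤ k) {x : CkLoop k} (hx : x ∈ Imm k) (u : ℝ) :
    field x u = resolvent x u - x u := by
  rw [field, dif_pos (resolvent_mem_loopSubmodule hk hx)]
  rfl

theorem field_coe (hk : 1 ≤ k) {x : CkLoop k} (hx : x ∈ Imm k) :
    (field x : ℝ → Plane) = fun u => resolvent x u - x u :=
  funext (field_apply hk hx)

theorem deriv_field (hk : 1 ≤ k) {x : CkLoop k} (hx : x ∈ Imm k) (u : ℝ) :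
    deriv (field x) u = ‖deriv x u‖ • resolventDeriv x u - deriv x u := by
  rw [field_coe hk hx]
  exact ((hasDerivAt_resolvent hk x u).sub (x.hasDerivAt hk u)).deriv

/-- Curves in a ball of `C^k` whose speed is bounded below. -/
def region (k : ℕ) (c M : ℝ) : Set (CkLoop k) := {x | (∀ u, c ≤ ‖deriv x u‖) ∧ ‖x‖ ≤ M}

variable {c M : ℝ}

theorem region_subset_imm (hc : 0 < c) : region k c M ⊆ Imm k := fun _ hx => mem_imm_of_le hc hx.1

theorem unifBound_region : UnifBound (fun _ => 1) k (fun x : region k c M => (x.1 : ℝ → Plane)) :=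
  CkLoop.unifBound (C := M) fun x => by simpa using x.2.2

theorem exists_norm_field_le (hc : 0 < c) (M : ℝ) :
    ∃ C, 0 ≤ C ∧ ∀ x ∈ region (m + 1) c M, ‖field x‖ ≤ C := by
  have h := (unifBound_resolvent (ι := region (m + 1) c M) (x := fun x => x.1) hc
    (fun x => x.2.1) unifBound_region).sub unifBound_region
  obtain ⟨C, hC0, hC⟩ := CkLoop.norm_le_of_unifBound
    (x := fun x : region (m + 1) c M => field x.1) (d := fun _ => 1) (fun _ => zero_le_one) (by
      convert h using 2 with x
      exact field_coe (Nat.le_add_left 1 m) (region_subset_imm hc x.2))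
  exact ⟨C, hC0, fun x hx => by simpa using hC ⟨x, hx⟩⟩

theorem exists_norm_field_sub_le (hc : 0 < c) (M : ℝ) :
    ∃ C, 0 ≤ C ∧ ∀ x ∈ region (m + 1) c M, ∀ y ∈ region (m + 1) c M,
      ‖field x - field y‖ ≤ C * ‖x - y‖ := by
  have hxy : UnifBound (fun p : region (m + 1) c M × region (m + 1) c M => ‖p.1.1 - p.2.1‖) (m + 1)
      (fun p u => p.1.1 u - p.2.1 u) :=
    CkLoop.unifBound (x := fun p : region (m + 1) c M × region (m + 1) c M => p.1.1 - p.2.1) (C := 1) fun p => by rw [one_mul]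
  have h := (unifBound_resolvent_sub (ι := region (m + 1) c M × region (m + 1) c M)
    (x := fun p => p.1.1) (y := fun p => p.2.1) hc (fun p => p.1.2.1) (fun p => p.2.2.1)
    (unifBound_region.comp Prod.fst) (unifBound_region.comp Prod.snd) hxy).sub hxy
  obtain ⟨C, hC0, hC⟩ := CkLoop.norm_le_of_unifBound
    (x := fun p : region (m + 1) c M × region (m + 1) c M => field p.1.1 - field p.2.1)
    (d := fun p => ‖p.1.1 - p.2.1‖) (fun _ => norm_nonneg _) (by
      convert h using 3 with p u
      rw [CkLoop.sub_apply, field_apply (Nat.le_add_left 1 m) (region_subset_imm hc p.1.2),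
        field_apply (Nat.le_add_left 1 m) (region_subset_imm hc p.2.2)]
      abel)
  exact ⟨C, hC0, fun x hx y hy => hC ⟨⟨x, hx⟩, ⟨y, hy⟩⟩⟩

/-- In `y' = |x'| w` the lower norm already bounds `w` to order `m + 1`, and to that order `|x'|` is
linear in the top norm by `UnifBound.norm`. -/
theorem exists_norm_field_le_affine (hc : 0 < c) (M : ℝ) :
    ∃ C, 0 ≤ C ∧ ∀ x : CkLoop (m + 2), CkLoop.incl (m + 2) (m + 1) (Nat.le_succ _) x ∈
      region (m + 1) c M → ‖field x‖ ≤ C * (1 + ‖x‖) := by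
  set ι := {x : CkLoop (m + 2) //
    CkLoop.incl (m + 2) (m + 1) (Nat.le_succ _) x ∈ region (m + 1) c M}
  set d : ι → ℝ := fun x => 1 + ‖x.1‖
  have h2 : 1 ≤ m + 2 := by omega
  have hd0 : ∀ x, 0 ≤ d x := fun x => by positivity
  have hd1 : ∀ x, 1 ≤ d x := fun x => le_add_of_nonneg_right (norm_nonneg _)
  have hlow : UnifBound (fun _ => 1) (m + 1) (fun x : ι => (x.1 : ℝ → Plane)) :=
    (unifBound_region (k := m + 1) (c := c) (M := M)).comp
      (fun x : ι => ⟨CkLoop.incl (m + 2) (m + 1) (Nat.le_succ _) x.1, x.2⟩)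
  have hhigh : UnifBound d (m + 2) (fun x : ι => (x.1 : ℝ → Plane)) :=
    CkLoop.unifBound (x := fun x : ι => x.1) (C := 1) fun x => by
      rw [one_mul]
      exact le_add_of_nonneg_left zero_le_one
  have hx0 : ∀ x : ι, x.1 ∈ Imm (m + 2) := fun x => mem_imm_of_le hc x.2.1
  have hσ : UnifBound d (m + 1) (fun (x : ι) u => ‖deriv x.1 u‖) := by
    exact UnifBound.norm hc (fun x => x.2.1)
      (fun _ h => hlow.2.2.mono (Nat.lt_succ_iff.mp h)) hhigh.2.2
  have hw : UnifBound (fun _ => 1) (m + 1) (fun x : ι => resolventDeriv x.1) :=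
    unifBound_resolventDeriv
      (x := fun x : ι => CkLoop.incl (m + 2) (m + 1) (Nat.le_succ _) x.1) hc (fun x => x.2.1) hlow
  have hy : UnifBound d (m + 2) (fun x : ι => resolvent x.1) := by
    refine UnifBound.of_hasDerivAt (fun x u => hasDerivAt_resolvent h2 x.1 u)
      ⟨1, fun x u => ?_⟩ (hσ.smul' hw)
    rw [one_mul]
    exact (norm_resolvent_le h2 (hx0 x) u).trans (le_add_of_nonneg_left zero_le_one)
  obtain ⟨C, hC0, hC⟩ := CkLoop.norm_le_of_unifBound (x := fun x : ι => field x.1) hd0 (by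
      convert hy.sub hhigh using 2 with x
      exact field_coe h2 (hx0 x))
  exact ⟨C, hC0, fun x hx => hC ⟨x, hx⟩⟩

end Field

/-! ### Continuation of solutions of autonomous equations. -/

section GlobalExistence

open scoped NNReal

variable {E : Type*} [NormedAddCommGroup E] [NormedSpace ℝ E]

/-- `X` solves the autonomous equation `X' = F X` inside `D` on `(-a, a)`, starting at `x₀`. -/
def IsSolution (F : E → E) (D : Set E) (x₀ : E) (a : ℝ) (X : ℝ → E) : Prop :=
  X 0 = x₀ ∧ ∀ t ∈ Ioo (-a) a, X t ∈ D ∧ HasDerivAt X (F (X t)) t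

theorem IsSolution.mono {F : E → E} {D : Set E} {x₀ : E} {a b : ℝ} {X : ℝ → E}
    (h : IsSolution F D x₀ a X) (hb : b ≤ a) : IsSolution F D x₀ b X :=
  ⟨h.1, fun t ht => h.2 t ⟨by linarith [ht.1], by linarith [ht.2]⟩⟩

/-- The Picard fixed point is used directly because the solution must also be known to stay in the
ball. -/
theorem exists_mem_closedBall_hasDerivAt [CompleteSpace E] {F : E → E}
    {tmin tmax : ℝ} {t₀ : Icc tmin tmax} {z : E} {r L K : ℝ≥0}
    (hPL : IsPicardLindelof (fun _ => F) t₀ z r 0 L K) :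
    ∃ Y : ℝ → E, Y t₀ = z ∧ ∀ t ∈ Ioo tmin tmax,
      Y t ∈ Metric.closedBall z r ∧ HasDerivAt Y (F (Y t)) t := by
  have hz : z ∈ Metric.closedBall z ((0 : ℝ≥0) : ℝ) := Metric.mem_closedBall_self le_rfl
  obtain ⟨α, hα⟩ := ODE.FunSpace.exists_isFixedPt_next hPL hz
  have hball : ∀ t, α.compProj t ∈ Metric.closedBall z r :=
    fun t => α.compProj_mem_closedBall hPL.mul_max_le
  refine ⟨α.compProj, by rw [ODE.FunSpace.compProj_val, ← hα, ODE.FunSpace.next_apply₀],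
    fun t ht => ⟨hball t, ?_⟩⟩
  have hd : HasDerivWithinAt α.compProj (F (α.compProj t)) (Icc tmin tmax) t := by
    refine (ODE.hasDerivWithinAt_picard_Icc t₀.2
      hPL.continuousOn_uncurry α.continuous_compProj.continuousOn (fun t' _ => hball t') z
      (Ioo_subset_Icc_self ht)).congr_of_mem ?_ (Ioo_subset_Icc_self ht)
    intro t' ht'
    nth_rw 1 [← hα]
    rw [ODE.FunSpace.compProj_of_mem ht', ODE.FunSpace.next_apply]
  exact hd.hasDerivAt (Icc_mem_nhds ht.1 ht.2)

theorem exists_local_solution [CompleteSpace E] {F : E → E} {z : E} {r C δ : ℝ} {K : ℝ≥0}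
    (hr : 0 < r) (hδ : 0 < δ) (hlip : LipschitzOnWith K F (Metric.closedBall z r))
    (hC0 : 0 ≤ C) (hC : ∀ v ∈ Metric.closedBall z r, ‖F v‖ ≤ C) (hδC : C * δ ≤ r) (t₀ : ℝ) :
    ∃ Y : ℝ → E, Y t₀ = z ∧ ∀ t ∈ Ioo (t₀ - δ) (t₀ + δ),
      Y t ∈ Metric.closedBall z r ∧ HasDerivAt Y (F (Y t)) t := by
  have ht₀ : t₀ ∈ Icc (t₀ - δ) (t₀ + δ) := ⟨by linarith, by linarith⟩
  lift r to ℝ≥0 using hr.le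
  lift C to ℝ≥0 using hC0
  exact exists_mem_closedBall_hasDerivAt (IsPicardLindelof.of_time_independent (t₀ := ⟨t₀, ht₀⟩) (r := 0) hC hlip
    (by simpa using hδC))

variable {F : E → E} {D V : Set E} {x₀ : E} {K : ℝ≥0}

theorem IsSolution.eqOn {a : ℝ} {X Y : ℝ → E} (ha : 0 < a) (hlip : LipschitzOnWith K F V)
    (hX : IsSolution F D x₀ a X) (hY : IsSolution F D x₀ a Y) (hXV : ∀ t ∈ Ioo (-a) a, X t ∈ V)
    (hYV : ∀ t ∈ Ioo (-a) a, Y t ∈ V) : EqOn X Y (Ioo (-a) a) :=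
  ODE_solution_unique_of_mem_Ioo (v := fun _ => F) (s := fun _ => V) (t₀ := 0) (fun _ _ => hlip)
    ⟨by linarith, ha⟩ (fun t ht => ⟨(hX.2 t ht).2, hXV t ht⟩)
    (fun t ht => ⟨(hY.2 t ht).2, hYV t ht⟩) (hX.1.trans hY.1.symm)

/-- Three solutions of an autonomous equation, the outer two meeting the middle one at `-b` and
at `b`, combine to one. -/
theorem IsSolution.glue {a b δ : ℝ} {X Y Z : ℝ → E} (hlip : LipschitzOnWith K F V) (hVD : V ⊆ D)
    (hb : 0 ≤ b) (hba : b < a) (hδ : 0 < δ) (hX : IsSolution F D x₀ a X)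
    (hXV : ∀ t ∈ Ioo (-a) a, X t ∈ V) (hYb : Y (-b) = X (-b)) (hZb : Z b = X b)
    (hY : ∀ t ∈ Ioo (-b - δ) (-b + δ), Y t ∈ V ∧ HasDerivAt Y (F (Y t)) t)
    (hZ : ∀ t ∈ Ioo (b - δ) (b + δ), Z t ∈ V ∧ HasDerivAt Z (F (Z t)) t) :
    ∃ W, IsSolution F D x₀ (b + δ) W := by
  have hXe : ∀ t₀, t₀ ∈ Ioo (-a) a → ∀ᶠ t in 𝓝 t₀, HasDerivAt X (F (X t)) t ∧ X t ∈ V :=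
    fun t₀ ht₀ => eventually_of_mem (Ioo_mem_nhds ht₀.1 ht₀.2) fun t ht => ⟨(hX.2 t ht).2, hXV t ht⟩
  have heqY : X =ᶠ[𝓝 (-b)] Y :=
    ODE_solution_unique_of_eventually (v := fun _ => F) (s := fun _ => V)
      (Eventually.of_forall fun _ => hlip) (hXe (-b) ⟨by linarith, by linarith⟩)
      (eventually_of_mem (Ioo_mem_nhds (by linarith) (by linarith)) fun t ht => (hY t ht).symm)
      hYb.symm
  have heqZ : X =ᶠ[𝓝 b] Z :=
    ODE_solution_unique_of_eventually (v := fun _ => F) (s := fun _ => V)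
      (Eventually.of_forall fun _ => hlip) (hXe b ⟨by linarith, by linarith⟩)
      (eventually_of_mem (Ioo_mem_nhds (by linarith) (by linarith)) fun t ht => (hZ t ht).symm)
      hZb.symm
  set W : ℝ → E := fun t => if b < t then Z t else if t < -b then Y t else X t with hW
  have hWmid : ∀ t ∈ Icc (-b) b, W t = X t := fun t ht => by
    simp only [hW, if_neg (not_lt.mpr ht.2), if_neg (not_lt.mpr ht.1)]
  refine ⟨W, (hWmid 0 ⟨by linarith, hb⟩).trans hX.1, fun t ht => ?_⟩
  have key : ∀ U : ℝ → E, W =ᶠ[𝓝 t] U → (U t ∈ D ∧ HasDerivAt U (F (U t)) t) →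
      W t ∈ D ∧ HasDerivAt W (F (W t)) t := by
    rintro U hU ⟨h1, h2⟩
    rw [hU.eq_of_nhds]
    exact ⟨h1, h2.congr_of_eventuallyEq hU⟩
  rcases lt_or_ge b t with h | h
  · refine key Z ?_ ((hZ t ⟨by linarith, ht.2⟩).imp_left fun h => hVD h)
    filter_upwards [Ioi_mem_nhds h] with s hs
    exact if_pos hs
  rcases lt_or_ge t (-b) with h' | h'
  · refine key Y ?_ ((hY t ⟨by linarith [ht.1], by linarith⟩).imp_left fun h => hVD h)
    filter_upwards [Iio_mem_nhds h'] with s hs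
    have hs' : ¬ b < s := by
      have : s < -b := hs
      linarith
    simp only [hW, if_neg hs', if_pos (show s < -b from hs)]
  · refine key X ?_ (hX.2 t ⟨by linarith, by linarith⟩)
    have h1 : ∀ᶠ s in 𝓝 t, b < s → Z s = X s := by
      rcases h.eq_or_lt with rfl | h
      · filter_upwards [heqZ] with s hs _ using hs.symm
      · filter_upwards [Iio_mem_nhds h] with s hs hs' using absurd hs' (not_lt.mpr (le_of_lt hs))
    have h2 : ∀ᶠ s in 𝓝 t, s < -b → Y s = X s := by
      rcases h'.eq_or_lt with h' | h'
      · rw [← h']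
        filter_upwards [heqY] with s hs _ using hs.symm
      · filter_upwards [Ioi_mem_nhds h'] with s hs hs' using absurd hs' (not_lt.mpr (le_of_lt hs))
    filter_upwards [h1, h2] with s hs1 hs2
    simp only [hW]
    split_ifs with c1 c2
    · exact hs1 c1
    · exact hs2 c2
    · rfl

/-- An a priori bound, together with uniform Lipschitz and norm bounds near the bounded region,
gives existence up to the time for which the a priori bound holds. -/
theorem exists_isSolution_of_apriori [CompleteSpace E] {B : Set E} {T r C : ℝ} (hr : 0 < r)
    (hC0 : 0 ≤ C) (hVD : V ⊆ D) (hx₀ : x₀ ∈ B) (hBV : ∀ z ∈ B, Metric.closedBall z r ⊆ V)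
    (hlip : LipschitzOnWith K F V) (hC : ∀ v ∈ V, ‖F v‖ ≤ C)
    (hap : ∀ a ≤ T, ∀ X, IsSolution F D x₀ a X → ∀ t ∈ Ioo (-a) a, X t ∈ B) :
    ∃ X, IsSolution F D x₀ T X := by
  -- Every solution started in `B` lives for time `2δ`.
  set δ := r / (C + 1) / 2 with hδ
  have hδ0 : 0 < δ := by positivity
  have hCδ : C * (2 * δ) ≤ r := by
    rw [hδ, mul_div_cancel₀ _ two_ne_zero, mul_div_assoc', div_le_iff₀ (by positivity)]
    nlinarith
  have hloc : ∀ z ∈ B, ∀ t₀, ∃ Y : ℝ → E, Y t₀ = z ∧ ∀ t ∈ Ioo (t₀ - 2 * δ) (t₀ + 2 * δ),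
      Y t ∈ V ∧ HasDerivAt Y (F (Y t)) t := by
    intro z hz t₀
    obtain ⟨Y, hY0, hY⟩ := exists_local_solution hr (by positivity) (hlip.mono (hBV z hz)) hC0
      (fun v hv => hC v (hBV z hz hv)) hCδ t₀
    exact ⟨Y, hY0, fun t ht => ⟨hBV z hz (hY t ht).1, (hY t ht).2⟩⟩
  have hBV' : B ⊆ V := fun z hz => hBV z hz (Metric.mem_closedBall_self hr.le)
  have hstep : ∀ n : ℕ, (∃ X, IsSolution F D x₀ ((n + 1) * δ) X) ∨ ∃ X, IsSolution F D x₀ T X := by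
    intro n
    induction n with
    | zero =>
      left
      obtain ⟨Y, hY0, hY⟩ := hloc x₀ hx₀ 0
      refine ⟨Y, hY0, fun t ht => ?_⟩
      have h := hY t ⟨by norm_num at ht; linarith [ht.1], by norm_num at ht; linarith [ht.2]⟩
      exact ⟨hVD h.1, h.2⟩
    | succ n ih =>
      rcases ih with ⟨X, hX⟩ | h
      · rcases le_total ((n + 1) * δ) T with hT | hT
        · left
          -- Restarting at `±nδ`, a distance `δ` inside the open interval of existence, and running
          -- for `2δ` gives the radius `(n + 2)δ`.
          set b := (n : ℝ) * δ with hb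
          have hb0 : 0 ≤ b := by positivity
          have hab : ((n : ℝ) + 1) * δ = b + δ := by rw [hb]; ring
          have hXB := hap _ hT X hX
          rw [hab] at hX hXB
          obtain ⟨Y, hYb, hY⟩ := hloc (X (-b)) (hXB _ ⟨by linarith, by linarith⟩) (-b)
          obtain ⟨Z, hZb, hZ⟩ := hloc (X b) (hXB _ ⟨by linarith, by linarith⟩) b
          obtain ⟨W, hW⟩ := hX.glue hlip hVD hb0 (by linarith) (by positivity)
            (fun t ht => hBV' (hXB t ht)) hYb hZb hY hZ
          refine ⟨W, ?_⟩
          convert hW using 1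
          rw [hb]
          push_cast
          ring
        · exact Or.inr ⟨X, hX.mono hT⟩
      · exact Or.inr h
  obtain ⟨n, hn⟩ := exists_nat_ge (T / δ)
  rcases hstep n with ⟨X, hX⟩ | h
  · refine ⟨X, hX.mono ?_⟩
    rw [div_le_iff₀ hδ0] at hn
    linarith
  · exact h

/-- By uniqueness the solutions on `(-(n+1), n+1)` agree on overlaps, so near each `t` the
pieced-together function coincides with a single one of them. -/
theorem exists_global_of_forall_isSolution
    (hex : ∀ T : ℝ, 0 < T → ∃ X, IsSolution F D x₀ T X)
    (huniq : ∀ T : ℝ, 0 < T → ∀ X Y, IsSolution F D x₀ T X → IsSolution F D x₀ T Y →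
      EqOn X Y (Ioo (-T) T)) :
    ∃ X : ℝ → E, X 0 = x₀ ∧ ∀ t, X t ∈ D ∧ HasDerivAt X (F (X t)) t := by
  choose X hX using fun n : ℕ => hex (n + 1) (by positivity)
  have hag : ∀ (n m : ℕ) (t : ℝ), |t| < n + 1 → |t| < m + 1 → X n t = X m t := by
    intro n m t hn hm
    rcases le_total n m with h | h
    · exact huniq _ (by positivity) _ _ (hX n) ((hX m).mono (by
        have : (n : ℝ) ≤ m := by exact_mod_cast h
        linarith)) (abs_lt.mp hn)
    · exact huniq _ (by positivity) _ _ ((hX n).mono (by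
        have : (m : ℝ) ≤ n := by exact_mod_cast h
        linarith)) (hX m) (abs_lt.mp hm)
  have hfl : ∀ t : ℝ, |t| < (⌊|t|⌋₊ : ℝ) + 1 := fun t => Nat.lt_floor_add_one _
  set W : ℝ → E := fun t => X ⌊|t|⌋₊ t with hW
  refine ⟨W, ?_, fun t => ?_⟩
  · exact (hX _).1
  · set N := ⌊|t|⌋₊ with hN
    have hev : W =ᶠ[𝓝 t] X N := by
      filter_upwards [continuous_abs.continuousAt.eventually_lt continuousAt_const (hfl t)] with s hs
      exact hag _ _ _ (hfl s) hs
    have h := (hX N).2 t (abs_lt.mp (hfl t))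
    rw [hev.eq_of_nhds]
    exact ⟨h.1, h.2.congr_of_eventuallyEq hev⟩

end GlobalExistence

/-! ### A priori bounds, global existence and uniqueness. -/

section APriori

variable {k m : ℕ}

theorem le_of_hasDerivAt_nonneg {f f' : ℝ → ℝ} {a b s t : ℝ}
    (hf : ∀ r ∈ Ioo a b, HasDerivAt f (f' r) r) (hf' : ∀ r ∈ Ioo a b, 0 ≤ f' r) (hs : s ∈ Ioo a b)
    (ht : t ∈ Ioo a b) (hst : s ≤ t) : f s ≤ f t := by
  refine monotoneOn_of_deriv_nonneg (convex_Ioo a b)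
    (fun r hr => (hf r hr).continuousAt.continuousWithinAt) (fun r hr => ?_) (fun r hr => ?_)
    hs ht hst
  · rw [interior_Ioo] at hr
    exact (hf r hr).differentiableAt.differentiableWithinAt
  · rw [interior_Ioo] at hr
    rw [(hf r hr).deriv]
    exact hf' r hr

theorem norm_le_gronwallBound_of_affine {E : Type*} [NormedAddCommGroup E] [NormedSpace ℝ E]
    {X X' : ℝ → E} {a T C : ℝ} (haT : a ≤ T) (hC : 0 ≤ C)
    (hX : ∀ t ∈ Ioo (-a) a, HasDerivAt X (X' t) t)
    (hb : ∀ t ∈ Ioo (-a) a, ‖X' t‖ ≤ C * (1 + ‖X t‖)) (t : ℝ) (ht : t ∈ Ioo (-a) a) :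
    ‖X t‖ ≤ gronwallBound ‖X 0‖ C C T := by
  have key : ∀ Y Y' : ℝ → E, (∀ t ∈ Ioo (-a) a, HasDerivAt Y (Y' t) t) →
      (∀ t ∈ Ioo (-a) a, ‖Y' t‖ ≤ C * (1 + ‖Y t‖)) → ∀ t, 0 ≤ t → t < a →
      ‖Y t‖ ≤ gronwallBound ‖Y 0‖ C C T := by
    intro Y Y' hY hb t ht0 hta
    have hmem : ∀ s ∈ Icc 0 t, s ∈ Ioo (-a) a := fun s hs =>
      ⟨by linarith [hs.1], by linarith [hs.2]⟩
    have h := norm_le_gronwallBound_of_norm_deriv_right_le (f := Y) (f' := Y') (δ := ‖Y 0‖) (K := C)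
      (ε := C) (a := 0) (b := t)
      (fun s hs => (hY s (hmem s hs)).continuousAt.continuousWithinAt)
      (fun s hs => (hY s (hmem s (Ico_subset_Icc_self hs))).hasDerivWithinAt) le_rfl
      (fun s hs => (hb s (hmem s (Ico_subset_Icc_self hs))).trans_eq (by ring)) t
      (right_mem_Icc.mpr ht0)
    refine h.trans (gronwallBound_mono (norm_nonneg _) hC hC ?_)
    linarith
  rcases le_total 0 t with h | h
  · exact key X X' hX hb t h ht.2
  · have h2 := key (fun s => X (-s)) (fun s => -X' (-s)) (fun s hs => ?_) (fun s hs => ?_) (-t)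
      (by linarith) (by linarith [ht.1])
    · simpa using h2
    · exact (hX (-s) ⟨by linarith [hs.2], by linarith [hs.1]⟩).scomp_of_eq s (hasDerivAt_neg s) rfl
        |>.congr_deriv (by simp)
    · rw [norm_neg]
      exact hb (-s) ⟨by linarith [hs.2], by linarith [hs.1]⟩

theorem hasDerivAt_apply {X : ℝ → CkLoop k} {V : CkLoop k} {t : ℝ} (h : HasDerivAt X V t) (u : ℝ) :
    HasDerivAt (fun τ => X τ u) (V u) t := by
  have := (CkLoop.evalDeriv k 0 (Nat.zero_le k) u).hasFDerivAt.comp_hasDerivAt t h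
  simpa only [CkLoop.evalDeriv_zero, Function.comp_def] using this

theorem hasDerivAt_deriv_apply (hk : 1 ≤ k) {X : ℝ → CkLoop k} {V : CkLoop k} {t : ℝ}
    (h : HasDerivAt X V t) (u : ℝ) : HasDerivAt (fun τ => deriv (X τ) u) (deriv V u) t := by
  have := (CkLoop.evalDeriv k 1 hk u).hasFDerivAt.comp_hasDerivAt t h
  simpa only [CkLoop.evalDeriv_one, Function.comp_def] using this

/-- Evolution of the squared speed. -/
theorem hasDerivAt_normSq_deriv (hk : 1 ≤ k) {X : ℝ → CkLoop k} {t : ℝ} (hX : X t ∈ Imm k)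
    (h : HasDerivAt X (field (X t)) t) (u : ℝ) :
    HasDerivAt (fun τ => ‖deriv (X τ) u‖ ^ 2)
      (2 * (‖deriv (X t) u‖ * inner ℝ (deriv (X t) u) (resolventDeriv (X t) u) -
        ‖deriv (X t) u‖ ^ 2)) t := by
  refine (hasDerivAt_deriv_apply hk h u).norm_sq.congr_deriv ?_
  rw [deriv_field hk hX, inner_sub_right, real_inner_smul_right, real_inner_self_eq_norm_sq]

theorem abs_norm_mul_inner_le {E : Type*} [NormedAddCommGroup E] [InnerProductSpace ℝ E] {p w : E}
    {q : ℝ} (hw : ‖w‖ ≤ q) : |‖p‖ * inner ℝ p w| ≤ q * ‖p‖ ^ 2 := by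
  rw [abs_mul, abs_norm]
  calc ‖p‖ * |inner ℝ p w| ≤ ‖p‖ * (‖p‖ * q) :=
        mul_le_mul_of_nonneg_left ((abs_real_inner_le_norm p w).trans
          (mul_le_mul_of_nonneg_left hw (norm_nonneg p))) (norm_nonneg p)
    _ = q * ‖p‖ ^ 2 := by ring

/-- As `|w| ≤ 1`, the derivative of `|X'|²` lies between `-4|X'|²` and `0`. Forward in time
`e^{4t}|X'|²` does not decrease; backward in time `|X'|` does not decrease. -/
theorem speed_lower_bound (hk : 1 ≤ k) {X₀ : CkLoop k} {X : ℝ → CkLoop k} {a : ℝ}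
    (hX : IsSolution field (Imm k) X₀ a X) {t : ℝ} (ht : t ∈ Ioo (-a) a) (u : ℝ) :
    Real.exp (-(2 * |t|)) * ‖deriv X₀ u‖ ≤ ‖deriv (X t) u‖ := by
  have h0 : (0 : ℝ) ∈ Ioo (-a) a := ⟨by linarith [ht.1, ht.2], by linarith [ht.1, ht.2]⟩
  have hd := fun r (hr : r ∈ Ioo (-a) a) =>
    hasDerivAt_normSq_deriv hk (hX.2 r hr).1 (hX.2 r hr).2 u
  have hle := fun r (hr : r ∈ Ioo (-a) a) => abs_le.mp (abs_norm_mul_inner_le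
    (p := deriv (X r) u) (norm_resolventDeriv_le_one hk (hX.2 r hr).1 u))
  refine le_of_sq_le_sq ?_ (norm_nonneg _)
  rw [mul_pow, ← Real.exp_nat_mul, ← hX.1]
  rcases le_total 0 t with h | h
  · have h1 := le_of_hasDerivAt_nonneg
      (f := fun r => Real.exp (4 * r) * ‖deriv (X r) u‖ ^ 2)
      (fun r hr => (((hasDerivAt_id r).const_mul 4).exp).mul (hd r hr))
      (fun r hr => ?_) h0 ht h
    · rw [abs_of_nonneg h]
      have h2 : Real.exp (4 * t) ≠ 0 := (Real.exp_pos _).ne'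
      have h3 : ((2 : ℕ) : ℝ) * -(2 * t) = -(4 * t) := by push_cast; ring
      rw [h3, Real.exp_neg, inv_mul_le_iff₀ (Real.exp_pos _)]
      simpa using h1
    · have := (hle r hr).1
      have h5 := Real.exp_pos (4 * r)
      simp only [id, mul_one]
      nlinarith
  · have h1 := le_of_hasDerivAt_nonneg (f := fun r => -‖deriv (X r) u‖ ^ 2)
      (fun r hr => (hd r hr).neg) (fun r hr => ?_) ht h0 h
    · have h2 : Real.exp (((2 : ℕ) : ℝ) * -(2 * |t|)) ≤ 1 :=
        Real.exp_le_one_iff.mpr (by push_cast; linarith [abs_nonneg t])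
      calc _ ≤ 1 * ‖deriv (X 0) u‖ ^ 2 := mul_le_mul_of_nonneg_right h2 (by positivity)
        _ ≤ _ := by linarith
    · linarith [(hle r hr).2]

theorem norm_field_le_two_mul {x : CkLoop 1} (hx : x ∈ Imm 1) : ‖field x‖ ≤ 2 * ‖x‖ := by
  refine (CkLoop.norm_le_iff (by positivity)).mpr fun j hj u => ?_
  interval_cases j
  · rw [iteratedDeriv_zero, field_apply le_rfl hx]
    refine (norm_sub_le _ _).trans ?_
    linarith [norm_resolvent_le le_rfl hx u, x.norm_apply_le u]
  · rw [iteratedDeriv_one, deriv_field le_rfl hx]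
    refine (norm_sub_le _ _).trans ?_
    rw [norm_smul, norm_norm]
    have h1 := mul_le_mul_of_nonneg_left (norm_resolventDeriv_le_one le_rfl hx u)
      (norm_nonneg (deriv x u))
    linarith [x.norm_deriv_le le_rfl u]

theorem incl_field (x : CkLoop (m + 2)) (hx : x ∈ Imm (m + 2)) :
    CkLoop.incl (m + 2) (m + 1) (Nat.le_succ _) (field x) =
      field (CkLoop.incl (m + 2) (m + 1) (Nat.le_succ _) x) := by
  ext1 u
  exact (field_apply (by omega) hx u).trans
    (field_apply (x := CkLoop.incl (m + 2) (m + 1) (Nat.le_succ _) x) (by omega) hx u).symm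

/-- The constants depend on `T` but not on the lifetime `a`, which is what excludes blow-up. The
base order rests on `|w| ≤ 1`, the induction step on affine growth and Gronwall; `c` survives the
step since the speed involves only first derivatives. -/
theorem exists_region_of_isSolution {X₀ : CkLoop (m + 1)} (hX₀ : X₀ ∈ Imm (m + 1)) (T : ℝ) :
    ∃ c M, 0 < c ∧ ∀ a ≤ T, ∀ X, IsSolution field (Imm (m + 1)) X₀ a X →
      ∀ t ∈ Ioo (-a) a, X t ∈ region (m + 1) c M := by
  induction m with
  | zero =>
    obtain ⟨c, hc, hcX⟩ := exists_le_norm_deriv le_rfl hX₀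
    refine ⟨Real.exp (-(2 * T)) * c, gronwallBound ‖X₀‖ 2 2 T, by positivity,
      fun a ha X hX t ht => ⟨fun u => ?_, ?_⟩⟩
    · refine le_trans ?_ (speed_lower_bound le_rfl hX ht u)
      have : |t| ≤ T := (abs_lt.mpr ht).le.trans ha
      exact mul_le_mul (Real.exp_le_exp.mpr (by linarith)) (hcX u) hc.le (Real.exp_pos _).le
    · rw [← hX.1]
      refine norm_le_gronwallBound_of_affine ha zero_le_two (fun r hr => (hX.2 r hr).2)
        (fun r hr => (norm_field_le_two_mul (hX.2 r hr).1).trans ?_) t ht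
      linarith
  | succ m ih =>
    obtain ⟨c, M, hc, h⟩ := ih (X₀ := CkLoop.incl (m + 2) (m + 1) (Nat.le_succ _) X₀) hX₀
    obtain ⟨C, hC0, hC⟩ := exists_norm_field_le_affine (m := m) hc M
    refine ⟨c, gronwallBound ‖X₀‖ C C T, hc, fun a ha X hX => ?_⟩
    have hreg := h a ha (fun t => CkLoop.incl (m + 2) (m + 1) (Nat.le_succ _) (X t))
      ⟨congrArg _ hX.1, fun t ht => ⟨(hX.2 t ht).1, by
        rw [← incl_field _ (hX.2 t ht).1]
        exact (CkLoop.incl (m + 2) (m + 1) (Nat.le_succ _)).hasFDerivAt.comp_hasDerivAt t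
          (hX.2 t ht).2⟩⟩
    refine fun t ht => ⟨(hreg t ht).1, ?_⟩
    rw [← hX.1]
    exact norm_le_gronwallBound_of_affine ha hC0 (fun r hr => (hX.2 r hr).2)
      (fun r hr => hC _ (hreg r hr)) t ht

theorem closedBall_subset_region {c M : ℝ} {z : CkLoop (m + 1)} (hz : z ∈ region (m + 1) c M) :
    Metric.closedBall z (c / 2) ⊆ region (m + 1) (c / 2) (M + c / 2) := by
  intro x hx
  rw [Metric.mem_closedBall, dist_eq_norm] at hx
  have h1 := Nat.le_add_left 1 m
  constructor
  · intro u
    have h2 := (CkLoop.norm_deriv_le h1 (x - z) u).trans hx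
    have h3 : deriv (x - z) u = deriv x u - deriv z u := by
      simpa only [CkLoop.evalDeriv_one] using map_sub (CkLoop.evalDeriv (m + 1) 1 h1 u) x z
    rw [h3] at h2
    have h4 := norm_sub_norm_le (deriv z u) (deriv x u)
    rw [norm_sub_rev] at h4
    linarith [hz.1 u]
  · have := norm_sub_norm_le x z
    linarith [hz.2]

open scoped NNReal in
theorem exists_lipschitzOnWith_field {c : ℝ} (hc : 0 < c) (M : ℝ) :
    ∃ K : ℝ≥0, LipschitzOnWith K (field : CkLoop (m + 1) → _) (region (m + 1) c M) := by
  obtain ⟨K, hK0, hK⟩ := exists_norm_field_sub_le (m := m) hc M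
  refine ⟨⟨K, hK0⟩, LipschitzOnWith.of_dist_le_mul fun x hx y hy => ?_⟩
  rw [dist_eq_norm, dist_eq_norm]
  exact hK x hx y hy

theorem isSolution_eqOn {X₀ : CkLoop (m + 1)} (hX₀ : X₀ ∈ Imm (m + 1)) {T : ℝ} (hT : 0 < T)
    {X Y : ℝ → CkLoop (m + 1)} (hX : IsSolution field (Imm (m + 1)) X₀ T X)
    (hY : IsSolution field (Imm (m + 1)) X₀ T Y) : EqOn X Y (Ioo (-T) T) := by
  obtain ⟨c, M, hc, h⟩ := exists_region_of_isSolution hX₀ T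
  obtain ⟨K, hK⟩ := exists_lipschitzOnWith_field (m := m) hc M
  exact hX.eqOn hT hK hY (h T le_rfl X hX) (h T le_rfl Y hY)

theorem exists_isSolution {X₀ : CkLoop (m + 1)} (hX₀ : X₀ ∈ Imm (m + 1)) (T : ℝ) :
    ∃ X, IsSolution field (Imm (m + 1)) X₀ T X := by
  obtain ⟨c, M, hc, h⟩ := exists_region_of_isSolution hX₀ T
  obtain ⟨c₀, hc₀, hX₀c⟩ := exists_le_norm_deriv (Nat.le_add_left 1 m) hX₀
  -- The a priori bound speaks only of existing solutions, so the region is enlarged to contain `X₀`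
  -- itself.
  set c' := min c c₀
  set M' := max M ‖X₀‖
  have hc' : 0 < c' := lt_min hc hc₀
  obtain ⟨K, hK⟩ := exists_lipschitzOnWith_field (m := m) (half_pos hc') (M' + c' / 2)
  obtain ⟨C, hC0, hC⟩ := exists_norm_field_le (m := m) (half_pos hc') (M' + c' / 2)
  refine exists_isSolution_of_apriori (B := region (m + 1) c' M') (half_pos hc') hC0
    (region_subset_imm (half_pos hc')) ⟨fun u => (min_le_right _ _).trans (hX₀c u), le_max_right _ _⟩
    (fun z hz => closedBall_subset_region hz) hK hC fun a ha X hX t ht => ?_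
  exact ⟨fun u => (min_le_left _ _).trans ((h a ha X hX t ht).1 u),
    (h a ha X hX t ht).2.trans (le_max_left _ _)⟩

theorem exists_global_solution (hk : 1 ≤ k) {X₀ : CkLoop k} (hX₀ : X₀ ∈ Imm k) :
    ∃ X : ℝ → CkLoop k, X 0 = X₀ ∧ ∀ t, X t ∈ Imm k ∧ HasDerivAt X (field (X t)) t := by
  obtain ⟨m, rfl⟩ : ∃ m, k = m + 1 := ⟨k - 1, by omega⟩
  exact exists_global_of_forall_isSolution (fun T _ => exists_isSolution hX₀ T)
    fun T hT X Y hX hY => isSolution_eqOn hX₀ hT hX hY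

theorem global_solution_unique (hk : 1 ≤ k) {X₀ : CkLoop k} (hX₀ : X₀ ∈ Imm k)
    {X Y : ℝ → CkLoop k} (hX0 : X 0 = X₀) (hY0 : Y 0 = X₀)
    (hX : ∀ t, X t ∈ Imm k ∧ HasDerivAt X (field (X t)) t)
    (hY : ∀ t, Y t ∈ Imm k ∧ HasDerivAt Y (field (Y t)) t) : X = Y := by
  obtain ⟨m, rfl⟩ : ∃ m, k = m + 1 := ⟨k - 1, by omega⟩
  funext t
  have hT : |t| < |t| + 1 := lt_add_one _
  exact isSolution_eqOn hX₀ (T := |t| + 1) (by positivity) ⟨hX0, fun t _ => hX t⟩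
    ⟨hY0, fun t _ => hY t⟩ (abs_lt.mp hT)

theorem continuousAt_field (hk : 1 ≤ k) {x : CkLoop k} (hx : x ∈ Imm k) :
    ContinuousAt (field : CkLoop k → CkLoop k) x := by
  obtain ⟨m, rfl⟩ : ∃ m, k = m + 1 := ⟨k - 1, by omega⟩
  obtain ⟨c, hc, hxc⟩ := exists_le_norm_deriv hk hx
  obtain ⟨K, hK⟩ := exists_lipschitzOnWith_field (m := m) (half_pos hc) (‖x‖ + c / 2)
  exact hK.continuousOn.continuousAt (mem_of_superset (Metric.closedBall_mem_nhds x (half_pos hc))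
    (closedBall_subset_region ⟨hxc, le_rfl⟩))

/-- The pointwise equation on `[0, 1]` extends to all parameters by periodicity; conversely,
continuity of `field` makes a differentiable solution `C¹` in time. -/
theorem isEternalFlow_iff (hk : 1 ≤ k) {X : ℝ → CkLoop k} :
    IsEternalFlow k X ↔ ∀ t, X t ∈ Imm k ∧ HasDerivAt X (field (X t)) t := by
  constructor
  · intro h t
    refine ⟨h.mem_imm t, ?_⟩
    have hd := (h.contDiff.differentiable one_ne_zero t).hasDerivAt
    have heq : deriv X t = field (X t) := by
      have h01 : ∀ u ∈ Icc (0 : ℝ) 1, deriv X t u = field (X t) u := fun u hu => by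
        rw [field_apply hk (h.mem_imm t), ← velocity_eq hk (h.mem_imm t) hu]
        exact (hasDerivAt_apply hd u).unique (h.evolution t u hu)
      ext1 u
      have hp : Function.Periodic (fun u => deriv X t u - field (X t) u) 1 :=
        (deriv X t).periodic.sub (field (X t)).periodic
      obtain ⟨v, hv, huv⟩ := hp.exists_mem_Ico₀ one_pos u
      exact sub_eq_zero.mp (huv.trans (sub_eq_zero.mpr (h01 v ⟨hv.1, hv.2.le⟩)))
    rwa [heq] at hd
  · intro h
    refine ⟨?_, fun t => (h t).1, fun t u hu => ?_⟩
    · refine contDiff_one_iff_deriv.mpr ⟨fun t => (h t).2.differentiableAt, ?_⟩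
      rw [show deriv X = fun t => field (X t) from funext fun t => (h t).2.deriv]
      exact continuous_iff_continuousAt.mpr fun t =>
        (continuousAt_field hk (h t).1).comp (h t).2.continuousAt
    · rw [velocity_eq hk (h t).1 hu, ← field_apply hk (h t).1]
      exact hasDerivAt_apply (h t).2 u

end APriori

/-! ### Decay of length and speed, and separation of points. -/

section Embedding

variable {k : ℕ}

section Variation

variable {E : Type*} [NormedAddCommGroup E] [NormedSpace ℝ E] [CompleteSpace E]
  {f f' : ℝ → E} {g : ℝ → ℝ}

theorem norm_sub_le_integral (hf : ∀ u, HasDerivAt f (f' u) u) (hf' : Continuous f')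
    (hg : Continuous g) (hfg : ∀ u, ‖f' u‖ ≤ g u) {a b : ℝ} (hab : a ≤ b) :
    ‖f b - f a‖ ≤ ∫ v in a..b, g v := by
  rw [← intervalIntegral.integral_eq_sub_of_hasDerivAt (fun u _ => hf u)
    (hf'.intervalIntegrable a b)]
  exact intervalIntegral.norm_integral_le_of_norm_le hab (Eventually.of_forall fun u _ => hfg u)
    (hg.intervalIntegrable a b)

/-- The estimates along the two complementary arcs add up to the integral over one period. -/
theorem norm_sub_le_half_integral (hf : ∀ u, HasDerivAt f (f' u) u) (hf' : Continuous f')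
    (hg : Continuous g) (hfg : ∀ u, ‖f' u‖ ≤ g u) (hfp : Function.Periodic f 1)
    (hgp : Function.Periodic g 1) (u v : ℝ) :
    ‖f v - f u‖ ≤ 2⁻¹ * ∫ r in (0 : ℝ)..1, g r := by
  obtain ⟨w, hw, hvw⟩ := hfp.exists_mem_Ico one_pos v u
  rw [hvw]
  have h1 := norm_sub_le_integral hf hf' hg hfg hw.1
  have h2 := norm_sub_le_integral hf hf' hg hfg hw.2.le
  rw [hfp u, norm_sub_rev] at h2
  have h3 := intervalIntegral.integral_add_adjacent_intervals (hg.intervalIntegrable u w)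
    (hg.intervalIntegrable w (u + 1)) (μ := MeasureTheory.volume)
  have h4 := hgp.intervalIntegral_add_eq u 0
  rw [zero_add] at h4
  linarith

end Variation

theorem arcLength_sub_arcLength (hk : 1 ≤ k) (x : CkLoop k) (a b : ℝ) :
    arcLength x b - arcLength x a = ∫ v in a..b, ‖deriv x v‖ := by
  have h : ∀ a b, IntervalIntegrable (fun v => ‖deriv x v‖) MeasureTheory.volume a b :=
    fun a b => (x.continuous_deriv hk).norm.intervalIntegrable a b
  exact intervalIntegral.integral_interval_sub_left (h 0 b) (h 0 a)

theorem norm_sub_le_half_length (hk : 1 ≤ k) (x : CkLoop k) (u v : ℝ) :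
    ‖x v - x u‖ ≤ 2⁻¹ * length x :=
  norm_sub_le_half_integral (x.hasDerivAt hk) (x.continuous_deriv hk) (x.continuous_deriv hk).norm
    (fun _ => le_rfl) x.periodic (fun u => by simp only [x.periodic_deriv u]) u v

theorem continuous_resolvent (hk : 1 ≤ k) (x : CkLoop k) : Continuous (resolvent x) :=
  continuous_iff_continuousAt.mpr fun u => (hasDerivAt_resolvent hk x u).continuousAt

theorem continuous_resolventDeriv (hk : 1 ≤ k) (x : CkLoop k) : Continuous (resolventDeriv x) :=
  continuous_iff_continuousAt.mpr fun u => (hasDerivAt_resolventDeriv hk x u).continuousAt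

theorem norm_resolvent_sub_self_le (hk : 1 ≤ k) {x : CkLoop k} (hx : x ∈ Imm k) (u : ℝ) :
    ‖resolvent x u - x u‖ ≤ 2⁻¹ * length x :=
  norm_resolvent_sub_le hk hx (fun v => norm_sub_le_half_length hk x u v) u

/-- From `w_s = y - x` and `|y - x| ≤ L/2`, values of `w` differ by at most `½ · L · L/2`. Since `∫
w ds = ∫ dy = 0`, averaging turns this into a bound on `w`. -/
theorem norm_resolventDeriv_le (hk : 1 ≤ k) {x : CkLoop k} (hx : x ∈ Imm k) (u : ℝ) :
    ‖resolventDeriv x u‖ ≤ length x ^ 2 / 4 := by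
  have hρ := (x.continuous_deriv hk).norm
  have hL := length_pos hk hx
  have hw := continuous_resolventDeriv hk x
  have hosc : ∀ v, ‖resolventDeriv x u - resolventDeriv x v‖ ≤ length x ^ 2 / 4 := by
    intro v
    refine (norm_sub_le_half_integral (g := fun u => ‖deriv x u‖ * (2⁻¹ * length x))
      (hasDerivAt_resolventDeriv hk x)
      (hρ.smul ((continuous_resolvent hk x).sub x.continuous)) (hρ.mul continuous_const)
      (fun r => ?_) (periodic_resolventDeriv hk hx)
      (fun r => by simp only [x.periodic_deriv r]) v u).trans_eq ?_
    · rw [norm_smul, norm_norm]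
      exact mul_le_mul_of_nonneg_left (norm_resolvent_sub_self_le hk hx r) (norm_nonneg _)
    · rw [intervalIntegral.integral_mul_const]
      change 2⁻¹ * (length x * (2⁻¹ * length x)) = _
      ring
  have hmean : (∫ v in (0 : ℝ)..1, ‖deriv x v‖ • resolventDeriv x v) = 0 := by
    rw [intervalIntegral.integral_eq_sub_of_hasDerivAt (fun r _ => hasDerivAt_resolvent hk x r)
      ((hρ.smul hw).intervalIntegrable _ _), sub_eq_zero]
    simpa using periodic_resolvent hk hx 0
  have heq : (∫ v in (0 : ℝ)..1, ‖deriv x v‖ • (resolventDeriv x u - resolventDeriv x v)) =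
      length x • resolventDeriv x u := by
    have h1 : IntervalIntegrable (fun v => ‖deriv x v‖ • resolventDeriv x u)
        MeasureTheory.volume 0 1 := (hρ.smul continuous_const).intervalIntegrable _ _
    have h2 : IntervalIntegrable (fun v => ‖deriv x v‖ • resolventDeriv x v)
        MeasureTheory.volume 0 1 := (hρ.smul hw).intervalIntegrable _ _
    simp only [smul_sub]
    rw [intervalIntegral.integral_sub h1 h2, hmean, sub_zero, intervalIntegral.integral_smul_const]
    rfl
  have hle := intervalIntegral.norm_integral_le_of_norm_le (μ := MeasureTheory.volume)
    (f := fun v => ‖deriv x v‖ • (resolventDeriv x u - resolventDeriv x v))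
    (g := fun v => ‖deriv x v‖ * (length x ^ 2 / 4)) zero_le_one
    (Eventually.of_forall fun v _ => by
      rw [norm_smul, norm_norm]
      exact mul_le_mul_of_nonneg_left (hosc v) (norm_nonneg _))
    ((hρ.mul continuous_const).intervalIntegrable _ _)
  rw [heq, intervalIntegral.integral_mul_const, norm_smul, Real.norm_of_nonneg hL.le] at hle
  exact le_of_mul_le_mul_left hle hL

theorem le_zero_of_hasDerivAt_nonpos {f f' : ℝ → ℝ} (hf : ∀ r, 0 ≤ r → HasDerivAt f (f' r) r)
    (hf' : ∀ r, 0 ≤ r → f' r ≤ 0) {t : ℝ} (ht : 0 ≤ t) : f t ≤ f 0 := by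
  refine antitoneOn_of_deriv_nonpos (convex_Ici 0)
    (fun r hr => (hf r hr).continuousAt.continuousWithinAt) (fun r hr => ?_) (fun r hr => ?_)
    self_mem_Ici ht ht
  · exact (hf r (interior_subset hr)).differentiableAt.differentiableWithinAt
  · rw [(hf r (interior_subset hr)).deriv]
    exact hf' r (interior_subset hr)

section Flow

variable {X : ℝ → CkLoop k}

/-- `e^{2Φ}|X'|²` does not increase when `|w| ≤ 1 - Φ'`. The choices `0`, `t/2` and `t + B e^{-t}`
for `Φ` follow one another, each feeding the bound on `w` needed by the next. -/
theorem speed_le_of_norm_resolventDeriv_le (hk : 1 ≤ k)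
    (hX : ∀ t, X t ∈ Imm k ∧ HasDerivAt X (field (X t)) t) {Φ Φ' : ℝ → ℝ}
    (hΦ : ∀ r, HasDerivAt Φ (Φ' r) r) {u : ℝ}
    (hw : ∀ r, 0 ≤ r → ‖resolventDeriv (X r) u‖ ≤ 1 - Φ' r) {t : ℝ} (ht : 0 ≤ t) :
    ‖deriv (X t) u‖ ≤ Real.exp (Φ 0 - Φ t) * ‖deriv (X 0) u‖ := by
  refine le_of_sq_le_sq ?_ (by positivity)
  have h := le_zero_of_hasDerivAt_nonpos
    (f := fun r => Real.exp (2 * Φ r) * ‖deriv (X r) u‖ ^ 2)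
    (fun r _ => (((hΦ r).const_mul 2).exp).mul (hasDerivAt_normSq_deriv hk (hX r).1 (hX r).2 u))
    (fun r hr => ?_) ht
  · rw [mul_pow, ← Real.exp_nat_mul]
    have h1 : ((2 : ℕ) : ℝ) * (Φ 0 - Φ t) = 2 * Φ 0 - 2 * Φ t := by push_cast; ring
    rw [h1, Real.exp_sub, div_mul_eq_mul_div, le_div_iff₀ (Real.exp_pos _), mul_comm]
    exact h
  · have h1 := (abs_le.mp (abs_norm_mul_inner_le (p := deriv (X r) u) (hw r hr))).2
    have h2 := mul_nonneg (Real.exp_pos (2 * Φ r)).le (sub_nonneg.mpr h1)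
    linarith

theorem length_le_of_speed_le (hk : 1 ≤ k) {x y : CkLoop k} {c : ℝ}
    (h : ∀ u, ‖deriv x u‖ ≤ c * ‖deriv y u‖) : length x ≤ c * length y := by
  unfold length arcLength
  rw [← intervalIntegral.integral_const_mul]
  exact intervalIntegral.integral_mono zero_le_one
    ((x.continuous_deriv hk).norm.intervalIntegrable _ _)
    ((continuous_const.mul (y.continuous_deriv hk).norm).intervalIntegrable _ _) h

theorem length_nonneg (hk : 1 ≤ k) {x : CkLoop k} (hx : x ∈ Imm k) : 0 ≤ length x :=
  (length_pos hk hx).le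

/-- A bootstrap: `|w| ≤ 1` makes the length nonincreasing, so `|w| ≤ L₀²/4 ≤ 1/2` at all later
times, which leaves a decay rate of `1/2`. -/
theorem length_le_exp (hk : 1 ≤ k) (hX : ∀ t, X t ∈ Imm k ∧ HasDerivAt X (field (X t)) t)
    (hL : length (X 0) ^ 2 ≤ 2) {t : ℝ} (ht : 0 ≤ t) :
    length (X t) ≤ Real.exp (-(t / 2)) * length (X 0) := by
  have h1 : ∀ r, 0 ≤ r → length (X r) ≤ length (X 0) := by
    intro r hr
    have h := length_le_of_speed_le hk (x := X r) (y := X 0) (c := 1) fun u => by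
      simpa using speed_le_of_norm_resolventDeriv_le hk hX (Φ := fun _ => 0) (Φ' := fun _ => 0)
        (fun r => hasDerivAt_const r 0)
        (fun r _ => by simpa using norm_resolventDeriv_le_one hk (hX r).1 u) hr
    rwa [one_mul] at h
  refine length_le_of_speed_le hk fun u => ?_
  have h := speed_le_of_norm_resolventDeriv_le hk hX (Φ := fun r => r / 2) (Φ' := fun _ => 1 / 2)
    (fun r => (hasDerivAt_id r).div_const 2) (u := u) (fun r hr => ?_) ht
  · simpa using h
  · refine (norm_resolventDeriv_le hk (hX r).1 u).trans ?_
    have := pow_le_pow_left₀ (length_nonneg hk (hX r).1) (h1 r hr) 2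
    linarith

theorem norm_resolventDeriv_le_exp (hk : 1 ≤ k)
    (hX : ∀ t, X t ∈ Imm k ∧ HasDerivAt X (field (X t)) t)
    (hL : length (X 0) ^ 2 ≤ 2) {t : ℝ} (ht : 0 ≤ t) (u : ℝ) :
    ‖resolventDeriv (X t) u‖ ≤ length (X 0) ^ 2 / 4 * Real.exp (-t) := by
  refine (norm_resolventDeriv_le hk (hX t).1 u).trans ?_
  have h := pow_le_pow_left₀ (length_nonneg hk (hX t).1) (length_le_exp hk hX hL ht) 2
  rw [mul_pow, ← Real.exp_nat_mul, show ((2 : ℕ) : ℝ) * -(t / 2) = -t by push_cast; ring] at h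
  linarith

theorem speed_le_exp (hk : 1 ≤ k) (hX : ∀ t, X t ∈ Imm k ∧ HasDerivAt X (field (X t)) t)
    (hL : length (X 0) ^ 2 ≤ 2) {t : ℝ} (ht : 0 ≤ t) (u : ℝ) :
    ‖deriv (X t) u‖ ≤ Real.exp (length (X 0) ^ 2 / 4 - t) * ‖deriv (X 0) u‖ := by
  set B := length (X 0) ^ 2 / 4 with hB
  have h := speed_le_of_norm_resolventDeriv_le hk hX (Φ := fun r => r + B * Real.exp (-r))
    (Φ' := fun r => 1 - B * Real.exp (-r))
    (fun r => ((hasDerivAt_id r).add (((hasDerivAt_neg r).exp).const_mul B)).congr_deriv (by ring))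
    (u := u) (fun r hr => by
      rw [sub_sub_cancel]
      exact norm_resolventDeriv_le_exp hk hX hL hr u) ht
  refine h.trans (mul_le_mul_of_nonneg_right (Real.exp_le_exp.mpr ?_) (norm_nonneg _))
  have : 0 ≤ B * Real.exp (-t) := by positivity
  simp only [neg_zero, Real.exp_zero]
  linarith

/-- Rescaling by `e^r` cancels the `-x` in the field. The factors `e^r`, `e^{B-r}` from the speed
and `B e^{-r}` from `w` leave `B e^B e^{-r}`, whose time integral stays below `B e^B`. -/
theorem apply_ne_apply_of_chord_gt (hk : 1 ≤ k)
    (hX : ∀ t, X t ∈ Imm k ∧ HasDerivAt X (field (X t)) t) (hL : length (X 0) ^ 2 ≤ 2) {a b : ℝ}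
    (hab : a ≤ b)
    (hchord : (∫ v in a..b, ‖deriv (X 0) v‖) *
      (length (X 0) ^ 2 / 4 * Real.exp (length (X 0) ^ 2 / 4)) < ‖X 0 b - X 0 a‖)
    {t : ℝ} (ht : 0 ≤ t) : X t b ≠ X t a := by
  set B := length (X 0) ^ 2 / 4 with hB
  have hB0 : 0 ≤ B := by positivity
  set S := ∫ v in a..b, ‖deriv (X 0) v‖ with hS
  have hρ : ∀ r, Continuous fun v => ‖deriv (X r) v‖ := fun r => ((X r).continuous_deriv hk).norm
  set G : ℝ → Plane := fun r => Real.exp r • (X r b - X r a) with hG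
  have hGd : ∀ r, HasDerivAt G (Real.exp r • (resolvent (X r) b - resolvent (X r) a)) r := by
    intro r
    have h := (Real.hasDerivAt_exp r).smul
      ((hasDerivAt_apply (hX r).2 b).sub (hasDerivAt_apply (hX r).2 a))
    refine h.congr_deriv ?_
    rw [field_apply hk (hX r).1, field_apply hk (hX r).1, Pi.sub_apply]
    module
  have hbound : ∀ r, 0 ≤ r → ‖Real.exp r • (resolvent (X r) b - resolvent (X r) a)‖ ≤
      S * (B * Real.exp B) * Real.exp (-r) := by
    intro r hr
    have h1 := norm_sub_le_integral (hasDerivAt_resolvent hk (X r))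
      ((hρ r).smul (continuous_resolventDeriv hk (X r)))
      (g := fun v => Real.exp (B - r) * (B * Real.exp (-r)) * ‖deriv (X 0) v‖)
      (continuous_const.mul (hρ 0)) (fun v => by
        rw [norm_smul, norm_norm, mul_right_comm]
        exact mul_le_mul (speed_le_exp hk hX hL hr v) (norm_resolventDeriv_le_exp hk hX hL hr v)
          (norm_nonneg _) (by positivity)) hab
    rw [intervalIntegral.integral_const_mul] at h1
    rw [norm_smul, Real.norm_of_nonneg (Real.exp_pos r).le]
    refine (mul_le_mul_of_nonneg_left h1 (Real.exp_pos r).le).trans_eq ?_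
    rw [Real.exp_sub, Real.exp_neg]
    have := Real.exp_pos r
    field_simp
    rfl
  have hmain := image_norm_le_of_norm_deriv_right_le_deriv_boundary (a := 0) (b := t)
    (f := fun r => G r - G 0) (B := fun r => S * (B * Real.exp B) * (1 - Real.exp (-r)))
    (B' := fun r => S * (B * Real.exp B) * Real.exp (-r))
    (fun r _ => ((hGd r).sub_const _).continuousAt.continuousWithinAt)
    (fun r _ => ((hGd r).sub_const _).hasDerivWithinAt) (by simp)
    (fun r => ((((hasDerivAt_neg r).exp).const_sub 1).const_mul _).congr_deriv (by ring))
    (fun r hr => hbound r hr.1) (right_mem_Icc.mpr ht)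
  intro heq
  have hG0 : G 0 = X 0 b - X 0 a := by simp [hG]
  have hGt : G t = 0 := by simp only [hG, heq, sub_self, smul_zero]
  simp only [hGt, zero_sub, norm_neg, hG0] at hmain
  have hS0 : 0 ≤ S := intervalIntegral.integral_nonneg hab fun _ _ => norm_nonneg _
  have : S * (B * Real.exp B) * (1 - Real.exp (-t)) ≤ S * (B * Real.exp B) :=
    mul_le_of_le_one_right (by positivity) (by linarith [Real.exp_pos (-t)])
  linarith

end Flow

end Embedding

/-! ### Chord-arc ratio and the embedding criterion. -/

section Main

variable {k : ℕ}

theorem isEmbeddedLoop_of_injOn {x : CkLoop k} (hx : x ∈ Imm k)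
    (hinj : ∀ u v : ℝ, 0 ≤ u → u < v → v < 1 → x u ≠ x v) : IsEmbeddedLoop x := by
  have : Fact ((0 : ℝ) < 1) := ⟨one_pos⟩
  refine ⟨hx, (Continuous.isClosedEmbedding ?_ ?_).isEmbedding⟩
  · exact continuous_coinduced_dom.mpr x.continuous
  · have hrep : ∀ z : AddCircle (1 : ℝ), ∃ u ∈ Ico (0 : ℝ) 1, (u : AddCircle (1 : ℝ)) = z := by
      intro z
      have hz : z ∈ ((↑) : ℝ → AddCircle (1 : ℝ)) '' Ico (0 : ℝ) (0 + 1) := by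
        rw [AddCircle.coe_image_Ico_eq]
        trivial
      simpa using hz
    intro z w hzw
    obtain ⟨u, hu, rfl⟩ := hrep z
    obtain ⟨v, hv, rfl⟩ := hrep w
    have huv : x u = x v := hzw
    rcases lt_trichotomy u v with h | h | h
    · exact absurd huv (hinj u v hu.1 h hv.2)
    · rw [h]
    · exact absurd huv.symm (hinj v u hv.1 h hu.2)

/-- One of the two arcs joining two points of the circle realizes the arc distance. -/
theorem exists_arc (hk : 1 ≤ k) (x : CkLoop k) {u v : ℝ} (hu : 0 ≤ u) (huv : u < v) (hv : v < 1) :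
    ∃ a b, a < b ∧ arcDist x u v = (∫ r in a..b, ‖deriv x r‖) ∧
      ∀ y : CkLoop k, (y a = y u ∧ y b = y v) ∨ (y a = y v ∧ y b = y u) := by
  have hi : ∀ a b, IntervalIntegrable (fun v => ‖deriv x v‖) MeasureTheory.volume a b :=
    fun a b => (x.continuous_deriv hk).norm.intervalIntegrable a b
  have habs : |arcLength x u - arcLength x v| = ∫ r in u..v, ‖deriv x r‖ := by
    rw [abs_sub_comm, arcLength_sub_arcLength hk, abs_of_nonneg]
    exact intervalIntegral.integral_nonneg huv.le fun _ _ => norm_nonneg _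
  have hcompl : length x - (∫ r in u..v, ‖deriv x r‖) = ∫ r in v..(u + 1), ‖deriv x r‖ := by
    have h1 : Function.Periodic (fun r => ‖deriv x r‖) 1 := fun r => by
      simp only [x.periodic_deriv r]
    have h2 := h1.intervalIntegral_add_eq u 0
    rw [zero_add] at h2
    rw [length, arcLength, ← h2, sub_eq_iff_eq_add']
    exact (intervalIntegral.integral_add_adjacent_intervals (hi u v) (hi v (u + 1))).symm
  rw [arcDist, habs, hcompl]
  rcases le_total (∫ r in u..v, ‖deriv x r‖) (∫ r in v..(u + 1), ‖deriv x r‖) with h | h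
  · exact ⟨u, v, huv, min_eq_left h, fun y => Or.inl ⟨rfl, rfl⟩⟩
  · exact ⟨v, u + 1, by linarith, min_eq_right h, fun y => Or.inr ⟨rfl, y.periodic u⟩⟩

theorem arcDist_pos (hk : 1 ≤ k) {x : CkLoop k} (hx : x ∈ Imm k) {u v : ℝ} (hu : 0 ≤ u)
    (huv : u < v) (hv : v < 1) : 0 < arcDist x u v := by
  obtain ⟨a, b, hab, h, -⟩ := exists_arc hk x hu huv hv
  rw [h]
  exact intervalIntegral.intervalIntegral_pos_of_pos_on
    ((x.continuous_deriv hk).norm.intervalIntegrable _ _)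
    (fun u _ => norm_pos_iff.mpr (hx u)) hab

theorem norm_sub_le_arcDist (hk : 1 ≤ k) (x : CkLoop k) {u v : ℝ} (hu : 0 ≤ u)
    (huv : u < v) (hv : v < 1) : ‖x u - x v‖ ≤ arcDist x u v := by
  obtain ⟨a, b, hab, h, hy⟩ := exists_arc hk x hu huv hv
  have h1 := norm_sub_le_integral (x.hasDerivAt hk) (x.continuous_deriv hk)
    (x.continuous_deriv hk).norm (fun _ => le_rfl) hab.le
  rw [h]
  rcases hy x with ⟨ha, hb⟩ | ⟨ha, hb⟩
  · rwa [ha, hb, norm_sub_rev] at h1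
  · rwa [ha, hb] at h1

theorem chordArcInf_le (hk : 1 ≤ k) {x : CkLoop k} (hx : x ∈ Imm k) {u v : ℝ} (hu : 0 ≤ u)
    (huv : u < v) (hv : v < 1) : chordArcInf x ≤ ‖x u - x v‖ / arcDist x u v := by
  refine csInf_le ⟨0, ?_⟩ ⟨u, v, hu, huv, hv, rfl⟩
  rintro r ⟨u, v, hu, huv, hv, rfl⟩
  exact div_nonneg (norm_nonneg _) (arcDist_pos hk hx hu huv hv).le

theorem chordArcInf_le_one (hk : 1 ≤ k) {x : CkLoop k} (hx : x ∈ Imm k) : chordArcInf x ≤ 1 := by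
  have h0 : (0 : ℝ) < 1 / 2 := by norm_num
  have h1 : (1 / 2 : ℝ) < 1 := by norm_num
  exact (chordArcInf_le hk hx le_rfl h0 h1).trans
    (div_le_one_of_le₀ (norm_sub_le_arcDist hk x le_rfl h0 h1) (arcDist_pos hk hx le_rfl h0 h1).le)

/-- If `L² > 2`, the exponent `A` is at least `7/10` because `√2 ≥ 7/5`, and then `A e^A ≥ A (1 + A)
> 1`. -/
theorem sq_le_two_of_mul_exp_lt_one {L s : ℝ}
    (h : L ^ 2 * Real.sqrt (2 + s ^ 2) / 4 * Real.exp (L ^ 2 * Real.sqrt (2 + s ^ 2) / 4) < 1) :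
    L ^ 2 ≤ 2 := by
  by_contra! hL
  have hs : (7 / 5 : ℝ) ≤ Real.sqrt (2 + s ^ 2) := Real.le_sqrt_of_sq_le (by nlinarith [sq_nonneg s])
  have hA : (7 / 10 : ℝ) ≤ L ^ 2 * Real.sqrt (2 + s ^ 2) / 4 := by nlinarith
  have he := Real.add_one_le_exp (L ^ 2 * Real.sqrt (2 + s ^ 2) / 4)
  nlinarith

theorem isEmbeddedLoop_of_chordArcInf_gt (hk : 1 ≤ k) {X : ℝ → CkLoop k}
    (hX : ∀ t, X t ∈ Imm k ∧ HasDerivAt X (field (X t)) t)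
    (hchord : length (X 0) ^ 2 * Real.sqrt (2 + supNorm (X 0) ^ 2) / 4 *
      Real.exp (length (X 0) ^ 2 * Real.sqrt (2 + supNorm (X 0) ^ 2) / 4) < chordArcInf (X 0))
    {t : ℝ} (ht : 0 ≤ t) : IsEmbeddedLoop (X t) := by
  have hX0 := (hX 0).1
  have hL := sq_le_two_of_mul_exp_lt_one (hchord.trans_le (chordArcInf_le_one hk hX0))
  have hBA : length (X 0) ^ 2 / 4 ≤
      length (X 0) ^ 2 * Real.sqrt (2 + supNorm (X 0) ^ 2) / 4 := by
    have h1 : 1 ≤ Real.sqrt (2 + supNorm (X 0) ^ 2) :=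
      Real.one_le_sqrt.mpr (by nlinarith [sq_nonneg (supNorm (X 0))])
    exact div_le_div_of_nonneg_right (le_mul_of_one_le_right (sq_nonneg _) h1) (by norm_num)
  have hB : length (X 0) ^ 2 / 4 * Real.exp (length (X 0) ^ 2 / 4) < chordArcInf (X 0) :=
    (mul_le_mul hBA (Real.exp_le_exp.mpr hBA) (Real.exp_pos _).le (by positivity)).trans_lt hchord
  refine isEmbeddedLoop_of_injOn (hX t).1 fun u v hu huv hv => ?_
  -- The same `a` and `b` serve at time `0`, for the shorter arc, and at time `t`, for its
  -- endpoints.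
  obtain ⟨a, b, hab, hd, hy⟩ := exists_arc hk (X 0) hu huv hv
  have hratio := hB.trans_le (chordArcInf_le hk hX0 hu huv hv)
  rw [lt_div_iff₀ (arcDist_pos hk hX0 hu huv hv), hd, mul_comm] at hratio
  have hnorm : ‖X 0 u - X 0 v‖ = ‖X 0 b - X 0 a‖ := by
    rcases hy (X 0) with ⟨ha, hb⟩ | ⟨ha, hb⟩
    · rw [ha, hb, norm_sub_rev]
    · rw [ha, hb]
  rw [hnorm] at hratio
  have hne := apply_ne_apply_of_chord_gt hk hX hL hab.le hratio ht
  rcases hy (X t) with ⟨ha, hb⟩ | ⟨ha, hb⟩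
  · rw [ha, hb] at hne
    exact hne.symm
  · rwa [ha, hb] at hne

end Main

end H1Flow

end

theorem mainTheorem3 (k : ℕ) (hk : 1 ≤ k) (X₀ : H1Flow.CkLoop k) (hX₀ : X₀ ∈ H1Flow.Imm k) :
    (∃! X : ℝ → H1Flow.CkLoop k, H1Flow.IsEternalFlow k X ∧ X 0 = X₀) ∧
    (∀ X : ℝ → H1Flow.CkLoop k, H1Flow.IsEternalFlow k X → X 0 = X₀ →
      H1Flow.chordArcInf X₀ >
        H1Flow.length X₀ ^ 2 * Real.sqrt (2 + H1Flow.supNorm X₀ ^ 2) / 4 *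
          Real.exp (H1Flow.length X₀ ^ 2 * Real.sqrt (2 + H1Flow.supNorm X₀ ^ 2) / 4) →
      ∀ t : ℝ, 0 ≤ t → H1Flow.IsEmbeddedLoop (X t)) := by
  constructor
  · obtain ⟨X, hX0, hX⟩ := H1Flow.exists_global_solution hk hX₀
    exact ⟨X, ⟨(H1Flow.isEternalFlow_iff hk).mpr hX, hX0⟩, fun Y hY =>
      H1Flow.global_solution_unique hk hX₀ hY.2 hX0 ((H1Flow.isEternalFlow_iff hk).mp hY.1) hX⟩
  · rintro X hX rfl hchord t ht
    exact H1Flow.isEmbeddedLoop_of_chordArcInf_gt hk ((H1Flow.isEternalFlow_iff hk).mp hX) hchord ht
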